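/- Let $M\ge 1$, $\mu_1,\dots,\mu_M>0$, $\beta>0$, and let $\mathbf A=(\alpha_{i,j})\in\mathbb R^{M\times M}$ with $\alpha_{i,j}\ge 0$. For a realization $\{(u_k,t_k)\}$ of events (node $u_k\in[M]$, distinct times $t_k>0$, finitely many in every bounded window) and $T>0$, let $$\ell_T(\mathbf A)=\sum_{t_k<T}\log\Big(\mu_{u_k}+\sum_{t_i<t_k}\alpha_{u_i,u_k}e^{-\beta(t_k-t_i)}\Big)-\sum_{m=1}^M\mu_mT+\frac1\beta\sum_{m=1}^M\sum_{t_k<T}\alpha_{u_k,m}\big[e^{-\beta(T-t_k)}-1\big]$$ be the log-likelihood of the multivariate Hawkes process with exponential kernel, let $\mathcal C(i,t)=\{k: t_k<t,\ u_k=i\}$, and let $S_T^{(p,q)}(\mathbf A)=\partial\ell_T(\mathbf A)/\partial\alpha_{p,q}$. Then for all $p,q\in[M]$ this derivative exists and $$S_T^{(p,q)}(\mathbf A)=\sum_{k\in\mathcal C(q,T)}\frac{\sum_{i\in\mathcal C(p,t_k)}e^{-\beta(t_k-t_i)}}{\mu_q+\sum_{t_i<t_k}\alpha_{u_i,q}e^{-\beta(t_k-t_i)}}+\frac1\beta\sum_{k\in\mathcal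 C(p,T)}\big[e^{-\beta(T-t_k)}-1\big].$$ Let now the events be generated by a multivariate Hawkes process started at time $0$ with an empty past, that is, let the counting process $N_m$ of the events at node $m$ have, for every $m$, with respect to the history $\mathcal H_t=\sigma(N_i(s): i\in[M],\,s\le t)$, the conditional intensity $\lambda_m(t)=\mu_m+\sum_{t_i<t}\alpha_{u_i,m}e^{-\beta(t-t_i)}$, in the sense that $N_m(t)-\int_0^t\lambda_m(s)\,ds$ is an $(\mathcal H_t)$-martingale. If $\mathbf A=\mathbf 0$ (so that $N_1,\dots,N_M$ are independent Poisson processes with rates $\mu_1,\dots,\mu_M$), then every $S_T^{(p,q)}(\mathbf 0)$ is square integrable, and as $T\to\infty$ $$\operatorname{Var}\big[T^{-1/2}S_T^{(q,q)}(\mathbf 0)\big]\to\frac1{2\beta}+\frac{\mu_q}{\beta^2}\quad\text{for all }q,$$ $$\operatorname{Var}\big[T^{-1/2}S_T^{(p,q)}(\mathbf 0)\big]\to\frac{\mu_p}{\mu_q}\Big(\frac1{2\beta}+\frac{\mu_p}{\beta^2}\Big)\quad\text{for } p\ne q,$$ $$\operatorname{Cov}\big[T^{-1/2}S_T^{(p,q)}(\mathbf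 0),\,T^{-1/2}S_T^{(p',q)}(\mathbf 0)\big]\to\frac{\mu_p\mu_{p'}}{\mu_q\beta^2}\quad\text{for } p\ne p',$$ and all the remaining limits vanish: $\operatorname{Cov}\big[T^{-1/2}S_T^{(p,q)}(\mathbf 0),\,T^{-1/2}S_T^{(p',q')}(\mathbf 0)\big]\to 0$ whenever $q\ne q'$. -/

import Mathlib

open MeasureTheory ProbabilityTheory Filter
open scoped Topology NNReal

noncomputable section

namespace Hawkes

/-- A realization of a marked point process on the nodes `Fin M`: a set of events `(t, u)`
(`t` the time, `u` the node of the event), with positive times, finitely many events in every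
bounded time window, and no two events at the same time. -/
structure Realization (M : ℕ) where
  events : Set (ℝ × Fin M)
  time_pos : ∀ e ∈ events, 0 < e.1
  finite_upTo : ∀ t : ℝ, {e ∈ events | e.1 ≤ t}.Finite
  simple : Set.InjOn Prod.fst events

namespace Realization

variable {M : ℕ}

theorem finite_lt (x : Realization M) (t : ℝ) : {e ∈ x.events | e.1 < t}.Finite :=
  (x.finite_upTo t).subset fun _ he => ⟨he.1, he.2.le⟩

/-- The events strictly before time `t`. -/
def before (x : Realization M) (t : ℝ) : Finset (ℝ × Fin M) :=
  (x.finite_lt t).toFinset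

/-- `𝒞(i, t)`: the events at node `i` strictly before time `t`. -/
def nodeBefore (x : Realization M) (i : Fin M) (t : ℝ) : Finset (ℝ × Fin M) :=
  (x.before t).filter fun e => e.2 = i

/-- `N_m(t)`: the number of events at node `m` up to and including time `t`. -/
def count (x : Realization M) (m : Fin M) (t : ℝ) : ℕ :=
  {e ∈ x.events | e.1 ≤ t ∧ e.2 = m}.ncard

/-- The intensity `λ_m(t) = μ_m + ∑_{t_i < t} α_{u_i, m} e^{-β (t - t_i)}` of node `m` at time `t`,
for base intensities `μ`, influence matrix `A = (α_{i,j})` and decay rate `β`. -/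
def intensity (x : Realization M) (μ : Fin M → ℝ) (β : ℝ) (A : Matrix (Fin M) (Fin M) ℝ)
    (m : Fin M) (t : ℝ) : ℝ :=
  μ m + ∑ e ∈ x.before t, A e.2 m * Real.exp (-β * (t - e.1))

/-- The log-likelihood `ℓ_T(A)` of the events before time `T`. -/
def logLikelihood (x : Realization M) (μ : Fin M → ℝ) (β T : ℝ)
    (A : Matrix (Fin M) (Fin M) ℝ) : ℝ :=
  (∑ k ∈ x.before T,
      Real.log (μ k.2 + ∑ i ∈ x.before k.1, A i.2 k.2 * Real.exp (-β * (k.1 - i.1))))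
    - ∑ m, μ m * T
    + (1 / β) * ∑ m, ∑ k ∈ x.before T, A k.2 m * (Real.exp (-β * (T - k.1)) - 1)

/-- The score `S_T^{(p,q)}(A) = ∂ℓ_T(A) / ∂α_{p,q}`: the derivative of the log-likelihood at `A`
in the direction of the `(p, q)`-th coordinate. -/
def score (x : Realization M) (μ : Fin M → ℝ) (β T : ℝ) (p q : Fin M)
    (A : Matrix (Fin M) (Fin M) ℝ) : ℝ :=
  lineDeriv ℝ (x.logLikelihood μ β T) A (Matrix.single p q 1)

end Realization

variable {M : ℕ} {Ω : Type*} [MeasurableSpace Ω]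

/-- The vector of counting processes `(N_m(t))_m`. -/
def counts (N : Ω → Realization M) (t : ℝ≥0) (ω : Ω) : Fin M → ℝ :=
  fun m => ((N ω).count m t : ℝ)

/-- `N` is a multivariate Hawkes process with exponential kernel `α_{i,j} e^{-β t}`, started at
time `0` with an empty past: its counting processes are random variables, and for every node
`m` the conditional intensity of `N_m` with respect to the history `ℋ_t = σ(N_i(s) : i, s ≤ t)` is
`λ_m(t) = μ_m + ∑_i ∫_0^t α_{i,m} e^{-β (t - s)} N_i(ds)`, in the sense that
`N_m(t) - ∫_0^t λ_m(s) ds` is a martingale with respect to the history. -/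
structure IsHawkes (P : Measure Ω) (N : Ω → Realization M) (μ : Fin M → ℝ) (β : ℝ)
    (A : Matrix (Fin M) (Fin M) ℝ) : Prop where
  stronglyMeasurable_counts : ∀ t, StronglyMeasurable (counts N t)
  martingale : ∀ m, Martingale
    (fun (t : ℝ≥0) ω => counts N t ω m - ∫ s in (0 : ℝ)..t, (N ω).intensity μ β A m s)
    (Filtration.natural (counts N) stronglyMeasurable_counts) P

/-- The normalized score `T^{-1/2} S_T^{(p,q)}(A)`, as a random variable. -/
def normalizedScore (N : Ω → Realization M) (μ : Fin M → ℝ) (β T : ℝ) (p q : Fin M)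
    (A : Matrix (Fin M) (Fin M) ℝ) (ω : Ω) : ℝ :=
  T ^ (-(1 / 2) : ℝ) * (N ω).score μ β T p q A

end Hawkes

end

/-! Write `M_q(t) = N_q(t) - μ_q t` and `X_p(t) = ∑_{t_i < t, u_i = p} e^{-β(t - t_i)}`. At `A = 0`
the score is the stochastic integral `(1/μ_q) ∫_0^T X_p dM_q` (`score_zero`): the double sum over
events is the `dN_q` part, and integrating `X_p` over `[0, T]` gives the compensator. The `M_q` are
martingales, and since events are simple their quadratic covariations are `[M_q, M_q'] = δ_{qq'}
N_q`. By the Itô isometry the score is centred, scores with `q ≠ q'` are orthogonal, and for `q =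
q'` the covariance is `(1/μ_q) ∫_0^T E[X_p X_p'] dt`. A second use of the isometry, with a
deterministic integrand, gives `E[X_p X_p'] = δ_{pp'} μ_p (1 - e^{-2βt})/(2β) + μ_p μ_p' ((1 -
e^{-βt})/β)²`, and dividing the integral by `T` yields the limits. Independence of the Poisson
processes is never needed; the martingale property suffices.

The stochastic calculus is done on grids of mesh `T/(n+1)`, where the isometry is an exact identity
(`integral_discreteIntegral_mul_discreteIntegral`), resting on the conditional covariance of
compensated increments (`integral_mul_compIncrement_mul_compIncrement`). The discretized scores
converge almost surely (`tendsto_discreteScore`) and are dominated by a polynomial in the counts,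
which have all moments (`hasMoments_counts`), so means and covariances pass to the limit. -/

namespace Hawkes

/-! ### Derivative of the log-likelihood and the score at `A = 0`. -/

namespace Realization

variable {M : ℕ}

/-- The closed form of the partial derivatives of the log-likelihood. -/
theorem hasLineDerivAt_logLikelihood (x : Realization M) {μ : Fin M → ℝ} (hμ : ∀ m, 0 < μ m)
    (β T : ℝ) {A : Matrix (Fin M) (Fin M) ℝ} (hA : ∀ i j, 0 ≤ A i j) (p q : Fin M) :
    HasLineDerivAt ℝ (x.logLikelihood μ β T)
      ((∑ k ∈ x.nodeBefore q T,
          (∑ i ∈ x.nodeBefore p k.1, Real.exp (-β * (k.1 - i.1))) /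
            (μ q + ∑ i ∈ x.before k.1, A i.2 q * Real.exp (-β * (k.1 - i.1))))
        + (1 / β) * ∑ k ∈ x.nodeBefore p T, (Real.exp (-β * (T - k.1)) - 1))
      A (Matrix.single p q 1) := by
  set E : Matrix (Fin M) (Fin M) ℝ := Matrix.single p q 1 with hE
  have hcoord : ∀ i j, HasDerivAt (fun t : ℝ => (A + t • E) i j) (E i j) 0 := fun i j => by
    simpa using ((hasDerivAt_id (0 : ℝ)).mul_const (E i j)).const_add (A i j)
  have hlog : ∀ k : ℝ × Fin M, HasDerivAt (fun t : ℝ => Real.log (μ k.2 +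
      ∑ i ∈ x.before k.1, (A + t • E) i.2 k.2 * Real.exp (-β * (k.1 - i.1))))
      ((∑ i ∈ x.before k.1, E i.2 k.2 * Real.exp (-β * (k.1 - i.1))) /
        (μ k.2 + ∑ i ∈ x.before k.1, A i.2 k.2 * Real.exp (-β * (k.1 - i.1)))) 0 := fun k => by
    have h := (HasDerivAt.fun_sum (u := x.before k.1) fun i _ =>
      (hcoord i.2 k.2).mul_const (Real.exp (-β * (k.1 - i.1)))).const_add (μ k.2)
    have hpos : 0 < μ k.2 +
        ∑ i ∈ x.before k.1, A i.2 k.2 * Real.exp (-β * (k.1 - i.1)) :=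
      add_pos_of_pos_of_nonneg (hμ _) (Finset.sum_nonneg fun i _ =>
        mul_nonneg (hA _ _) (Real.exp_pos _).le)
    have h' := h.log (by simpa using hpos.ne')
    simpa using h'
  have hmain := ((HasDerivAt.fun_sum (u := x.before T) fun k _ => hlog k).sub_const
    (∑ m, μ m * T)).add ((HasDerivAt.fun_sum (u := Finset.univ) fun m _ =>
      HasDerivAt.fun_sum (u := x.before T) fun k _ =>
        (hcoord k.2 m).mul_const (Real.exp (-β * (T - k.1)) - 1)).const_mul (1 / β))
  have hEval : ∀ i j, E i j = if i = p then (if j = q then 1 else 0) else 0 := fun i j => by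
    simp only [hE, Matrix.single_apply, @eq_comm _ p i, @eq_comm _ q j, ite_and]
  rw [HasLineDerivAt]
  refine HasDerivAt.congr_deriv hmain (Eq.symm ?_)
  congr 1
  · rw [nodeBefore, Finset.sum_filter]
    refine Finset.sum_congr rfl fun k _ => ?_
    split_ifs with hk
    · subst hk
      rw [nodeBefore, Finset.sum_filter]
      congr 1
      refine Finset.sum_congr rfl fun i _ => ?_
      simp [hEval]
    · rw [Finset.sum_eq_zero (fun i _ => by rw [hEval]; simp [hk]), zero_div]
  · rw [nodeBefore, Finset.sum_filter, Finset.sum_comm]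
    congr 1
    refine Finset.sum_congr rfl fun k _ => ?_
    simp only [hEval]
    split_ifs <;> simp

/-- This is `(1/μ_q) ∫_0^T X_p (dN_q - μ_q dt)`: the second sum is the integral over `[0, T]` of the
excitation caused by the events at `p`. -/
theorem score_zero (x : Realization M) {μ : Fin M → ℝ} (hμ : ∀ m, 0 < μ m) (β T : ℝ)
    (p q : Fin M) :
    x.score μ β T p q 0 =
      (∑ k ∈ x.nodeBefore q T, ∑ i ∈ x.nodeBefore p k.1, Real.exp (-β * (k.1 - i.1))) / μ q
        - ∑ k ∈ x.nodeBefore p T, (1 - Real.exp (-β * (T - k.1))) / β := by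
  rw [score, (x.hasLineDerivAt_logLikelihood hμ β T (A := 0) (fun _ _ => le_rfl) p q).lineDeriv]
  simp only [Matrix.zero_apply, zero_mul, Finset.sum_const_zero, add_zero, Finset.sum_div,
    sub_eq_add_neg, Finset.mul_sum, ← Finset.sum_neg_distrib]
  congr 1
  exact Finset.sum_congr rfl fun k _ => by ring

/-! ### Increments of the counting processes -/

/-- The events at node `m` up to and including time `t`. -/
noncomputable def nodeUpTo (x : Realization M) (m : Fin M) (t : ℝ) : Finset (ℝ × Fin M) :=
  (x.finite_upTo t).toFinset.filter fun e => e.2 = m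

theorem mem_nodeUpTo {x : Realization M} {m : Fin M} {t : ℝ} {e : ℝ × Fin M} :
    e ∈ x.nodeUpTo m t ↔ (e ∈ x.events ∧ e.1 ≤ t) ∧ e.2 = m := by
  rw [nodeUpTo, Finset.mem_filter, Set.Finite.mem_toFinset, Set.mem_ofPred_eq]

theorem mem_nodeBefore {x : Realization M} {m : Fin M} {t : ℝ} {e : ℝ × Fin M} :
    e ∈ x.nodeBefore m t ↔ (e ∈ x.events ∧ e.1 < t) ∧ e.2 = m := by
  rw [nodeBefore, before, Finset.mem_filter, Set.Finite.mem_toFinset, Set.mem_ofPred_eq]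

theorem count_eq_card (x : Realization M) (m : Fin M) (t : ℝ) :
    x.count m t = (x.nodeUpTo m t).card := by
  rw [count, ← Set.ncard_coe_finset]
  congr 1
  ext e
  rw [Finset.mem_coe, mem_nodeUpTo, and_assoc]
  rfl

theorem count_mono (x : Realization M) (m : Fin M) : Monotone (x.count m) := fun s t hst => by
  rw [count_eq_card, count_eq_card]
  refine Finset.card_le_card fun e he => ?_
  rw [mem_nodeUpTo] at he ⊢
  exact ⟨⟨he.1.1, he.1.2.trans hst⟩, he.2⟩

theorem count_zero (x : Realization M) (m : Fin M) : x.count m 0 = 0 := by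
  rw [count_eq_card, Finset.card_eq_zero, Finset.eq_empty_iff_forall_notMem]
  intro e he
  rw [mem_nodeUpTo] at he
  exact absurd (x.time_pos e he.1.1) he.1.2.not_gt

/-- The index set depends on `T` only, so increments over different intervals become sums over the
same finite set and can be multiplied or interchanged. -/
theorem count_sub_count (x : Realization M) (m : Fin M) {s t T : ℝ} (hst : s ≤ t) (htT : t ≤ T) :
    (x.count m t : ℝ) - x.count m s =
      ∑ e ∈ x.nodeUpTo m T, if s < e.1 ∧ e.1 ≤ t then (1 : ℝ) else 0 := by
  have key : ∀ r ≤ T, (x.count m r : ℝ) = ∑ e ∈ x.nodeUpTo m T, if e.1 ≤ r then (1 : ℝ) else 0 := by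
    intro r hr
    rw [count_eq_card, ← Finset.sum_filter, Finset.sum_const, nsmul_eq_mul, mul_one]
    congr 2
    ext e
    simp only [Finset.mem_filter, mem_nodeUpTo]
    constructor
    · rintro ⟨⟨h1, h2⟩, h3⟩
      exact ⟨⟨⟨h1, h2.trans hr⟩, h3⟩, h2⟩
    · rintro ⟨⟨⟨h1, -⟩, h3⟩, h2⟩
      exact ⟨⟨h1, h2⟩, h3⟩
  rw [key t htT, key s (hst.trans htT), ← Finset.sum_sub_distrib]
  refine Finset.sum_congr rfl fun e _ => ?_
  by_cases h1 : e.1 ≤ s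
  · simp [h1, h1.trans hst, h1.not_gt]
  · simp [h1, not_le.1 h1]

/-- In a bounded window the event times are separated: over short intervals, at most one of the
counting processes jumps, and by one only. -/
theorem exists_increment_mul_increment (x : Realization M) (T : ℝ) :
    ∃ δ > 0, ∀ s t : ℝ, s ≤ t → t ≤ T → t - s < δ → ∀ m m' : Fin M,
      ((x.count m t : ℝ) - x.count m s) * ((x.count m' t : ℝ) - x.count m' s) =
        if m = m' then (x.count m t : ℝ) - x.count m s else 0 := by
  obtain ⟨δ, hδ, hsep⟩ : ∃ δ > 0, ∀ e ∈ x.events, e.1 ≤ T → ∀ e' ∈ x.events, e'.1 ≤ T →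
      |e.1 - e'.1| < δ → e = e' := by
    set F := (x.finite_upTo T).toFinset
    -- The gaps between distinct events up to `T`: finitely many, and positive because event times
    -- are distinct. Their minimum serves as `δ`, or `1` if there is no gap.
    set D := ((F ×ˢ F).filter fun z => z.1 ≠ z.2).image fun z => |z.1.1 - z.2.1|
    have hD : ∀ d ∈ D, 0 < d := by
      intro d hd
      simp only [D, F, Finset.mem_image, Finset.mem_filter, Finset.mem_product,
        Set.Finite.mem_toFinset] at hd
      obtain ⟨z, ⟨⟨h1, h2⟩, h3⟩, rfl⟩ := hd
      exact abs_pos.2 (sub_ne_zero.2 fun h => h3 (x.simple h1.1 h2.1 h))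
    obtain ⟨δ, hδ, hle⟩ : ∃ δ > 0, ∀ d ∈ D, δ ≤ d := by
      rcases D.eq_empty_or_nonempty with h | h
      · exact ⟨1, one_pos, by simp [h]⟩
      · exact ⟨D.min' h, hD _ (D.min'_mem h), fun d hd => D.min'_le d hd⟩
    refine ⟨δ, hδ, fun e he heT e' he' heT' hlt => ?_⟩
    by_contra hne
    refine (hle |e.1 - e'.1| ?_).not_gt hlt
    simp only [D, F, Finset.mem_image, Finset.mem_filter, Finset.mem_product,
      Set.Finite.mem_toFinset]
    exact ⟨(e, e'), ⟨⟨⟨he, heT⟩, he', heT'⟩, hne⟩, rfl⟩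
  refine ⟨δ, hδ, fun s t hst htT hlt m m' => ?_⟩
  rw [x.count_sub_count m hst htT, x.count_sub_count m' hst htT, Finset.sum_mul_sum]
  have hne : ∀ e ∈ x.nodeUpTo m T, ∀ e' ∈ x.nodeUpTo m' T, e ≠ e' →
      (if s < e.1 ∧ e.1 ≤ t then (1 : ℝ) else 0) *
        (if s < e'.1 ∧ e'.1 ≤ t then (1 : ℝ) else 0) = 0 := by
    intro e he e' he' hee
    rw [mem_nodeUpTo] at he he'
    split_ifs with h1 h2
    · refine absurd (hsep e he.1.1 he.1.2 e' he'.1.1 he'.1.2 ?_) hee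
      rw [abs_lt]
      constructor <;> linarith [h1.1, h1.2, h2.1, h2.2]
    all_goals simp
  split_ifs with hm
  · subst hm
    refine Finset.sum_congr rfl fun e he => ?_
    rw [Finset.sum_eq_single e (fun e' he' h => hne e he e' he' h.symm) (fun h => absurd he h)]
    split_ifs <;> simp
  · refine Finset.sum_eq_zero fun e he => Finset.sum_eq_zero fun e' he' => hne e he e' he' ?_
    rintro rfl
    rw [mem_nodeUpTo] at he he'
    exact hm (he.2.symm.trans he'.2)

end Realization

end Hawkes

namespace Hawkes

variable {M : ℕ} {Ω : Type*}

/-! ### Random variables with moments of all orders -/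

/-- The random variable `f` has finite moments of all orders. -/
def HasMoments [MeasurableSpace Ω] (f : Ω → ℝ) (P : Measure Ω) : Prop := ∀ p : ℕ, MemLp f p P

namespace HasMoments

variable [MeasurableSpace Ω] {P : Measure Ω} {f g : Ω → ℝ}

theorem integrable (hf : HasMoments f P) : Integrable f P := by
  simpa using memLp_one_iff_integrable.1 (by simpa using hf 1)

theorem add (hf : HasMoments f P) (hg : HasMoments g P) : HasMoments (fun ω => f ω + g ω) P :=
  fun p => (hf p).add (hg p)

theorem sub (hf : HasMoments f P) (hg : HasMoments g P) : HasMoments (fun ω => f ω - g ω) P :=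
  fun p => (hf p).sub (hg p)

theorem const [IsFiniteMeasure P] (c : ℝ) : HasMoments (fun _ : Ω => c) P :=
  fun _ => memLp_const c

theorem const_mul (hf : HasMoments f P) (c : ℝ) : HasMoments (fun ω => c * f ω) P :=
  fun p => (hf p).const_mul c

/-- Hölder with exponents `2p, 2p, p`. This closure under products is the reason for asking for
moments of all orders. -/
theorem mul (hf : HasMoments f P) (hg : HasMoments g P) : HasMoments (fun ω => f ω * g ω) P := by
  intro p
  have : ENNReal.HolderTriple ((2 * p : ℕ) : ENNReal) ((2 * p : ℕ) : ENNReal) p := ⟨by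
    push_cast
    rw [ENNReal.mul_inv (by simp) (by simp), ← add_mul, ENNReal.inv_two_add_inv_two, one_mul]⟩
  exact (hg (2 * p)).mul' (hf (2 * p))

theorem sum {ι : Type*} (s : Finset ι) {f : ι → Ω → ℝ} (hf : ∀ i ∈ s, HasMoments (f i) P) :
    HasMoments (fun ω => ∑ i ∈ s, f i ω) P :=
  fun p => memLp_finsetSum s fun i hi => hf i hi p

theorem mono (hg : HasMoments g P) (hf : AEStronglyMeasurable f P) (h : ∀ᵐ ω ∂P, |f ω| ≤ g ω) :
    HasMoments f P :=
  fun p => (hg p).mono' hf h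

end HasMoments

/-! ### Increments of the counting processes -/

/-- The number of events at node `m` in `(s, t]`. -/
noncomputable def increment (N : Ω → Realization M) (m : Fin M) (s t : ℝ≥0) (ω : Ω) : ℝ :=
  counts N t ω m - counts N s ω m

/-- The increment over `(s, t]` of the compensated process `N_m(t) - μ_m t`. -/
noncomputable def compIncrement (N : Ω → Realization M) (μ : Fin M → ℝ) (m : Fin M) (s t : ℝ≥0)
    (ω : Ω) : ℝ :=
  increment N m s t ω - μ m * (t - s)

theorem increment_nonneg (N : Ω → Realization M) (m : Fin M) {s t : ℝ≥0} (hst : s ≤ t) (ω : Ω) :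
    0 ≤ increment N m s t ω :=
  sub_nonneg.2 (Nat.cast_le.2 ((N ω).count_mono m (NNReal.coe_le_coe.2 hst)))

theorem increment_zero_left (N : Ω → Realization M) (m : Fin M) (t : ℝ≥0) (ω : Ω) :
    increment N m 0 t ω = counts N t ω m := by
  simp [increment, counts, Realization.count_zero]

theorem sum_increment (N : Ω → Realization M) (m : Fin M) (s h : ℝ≥0) (n : ℕ) (ω : Ω) :
    ∑ j ∈ Finset.range n, increment N m (s + j * h) (s + (j + 1 : ℕ) * h) ω =
      increment N m s (s + n * h) ω := by
  simp only [increment]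
  rw [Finset.sum_range_sub (fun j : ℕ => counts N (s + j * h) ω m)]
  simp

theorem exists_increment_mul_increment (N : Ω → Realization M) (T : ℝ≥0) (ω : Ω) :
    ∃ δ : ℝ, 0 < δ ∧ ∀ s t : ℝ≥0, s ≤ t → t ≤ T → (t : ℝ) - s < δ → ∀ m m' : Fin M,
      increment N m s t ω * increment N m' s t ω = if m = m' then increment N m s t ω else 0 := by
  obtain ⟨δ, hδ, h⟩ := (N ω).exists_increment_mul_increment T
  exact ⟨δ, hδ, fun s t hst htT hlt => h s t (by exact_mod_cast hst) (by exact_mod_cast htT) hlt⟩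

/-- On a sufficiently fine grid of `(s, s + L]`, every interval contains at most one event. -/
theorem eventually_increment_mul_increment (N : Ω → Realization M) (s L : ℝ≥0) (ω : Ω) :
    ∀ᶠ n : ℕ in atTop, ∀ j < n + 1, ∀ m m' : Fin M,
      increment N m (s + j * (L / (n + 1 : ℕ))) (s + (j + 1 : ℕ) * (L / (n + 1 : ℕ))) ω *
        increment N m' (s + j * (L / (n + 1 : ℕ))) (s + (j + 1 : ℕ) * (L / (n + 1 : ℕ))) ω =
      if m = m' then
        increment N m (s + j * (L / (n + 1 : ℕ))) (s + (j + 1 : ℕ) * (L / (n + 1 : ℕ))) ω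
      else 0 := by
  obtain ⟨δ, hδ, h⟩ := exists_increment_mul_increment N (s + L) ω
  have hlim : Tendsto (fun n : ℕ => (L : ℝ) / ((n + 1 : ℕ) : ℝ)) atTop (𝓝 0) :=
    (tendsto_const_div_atTop_nhds_zero_nat (L : ℝ)).comp (tendsto_add_atTop_nat 1)
  filter_upwards [hlim.eventually (gt_mem_nhds hδ)] with n hn j hj m m'
  refine h _ _ ?_ ?_ ?_ m m'
  · gcongr
    simp
  · gcongr
    calc ((j + 1 : ℕ) : ℝ≥0) * (L / (n + 1 : ℕ)) ≤ (n + 1 : ℕ) * (L / (n + 1 : ℕ)) := by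
          gcongr
          exact Nat.le_of_lt_succ hj
      _ = L := mul_div_cancel₀ _ (by positivity)
  · push_cast at hn ⊢
    linarith

/-! ### Consequences of the martingale property at `A = 0`. -/

namespace IsHawkes

variable [MeasurableSpace Ω] {P : Measure Ω} {N : Ω → Realization M} {μ : Fin M → ℝ} {β : ℝ}

/-- The history `ℋ_t = σ(N_i(s) : i, s ≤ t)`. -/
noncomputable abbrev history {A : Matrix (Fin M) (Fin M) ℝ} (hN : IsHawkes P N μ β A) :
    Filtration ℝ≥0 ‹MeasurableSpace Ω› :=
  Filtration.natural (counts N) hN.stronglyMeasurable_counts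

variable (hN : IsHawkes P N μ β 0)

include hN

theorem stronglyMeasurable_increment (m : Fin M) {s t r : ℝ≥0} (hs : s ≤ r) (ht : t ≤ r) :
    StronglyMeasurable[hN.history r] (increment N m s t) := by
  have key : ∀ u ≤ r, StronglyMeasurable[hN.history r] fun ω => counts N u ω m := fun u hu =>
    (continuous_apply m).comp_stronglyMeasurable
      (((Filtration.stronglyAdapted_natural hN.stronglyMeasurable_counts) u).mono
        (hN.history.mono hu))
  exact (key t ht).sub (key s hs)

theorem stronglyMeasurable_compIncrement (m : Fin M) {s t r : ℝ≥0} (hs : s ≤ r) (ht : t ≤ r) :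
    StronglyMeasurable[hN.history r] (compIncrement N μ m s t) :=
  (hN.stronglyMeasurable_increment m hs ht).sub stronglyMeasurable_const

/-- Without interaction the intensity is the constant `μ_m`, so the compensator is deterministic. -/
theorem martingale_compensated (m : Fin M) :
    Martingale (fun (t : ℝ≥0) ω => counts N t ω m - μ m * t) hN.history P := by
  have h := hN.martingale m
  simpa [Realization.intensity, mul_comm] using h

theorem integrable_compIncrement (m : Fin M) (s t : ℝ≥0) :
    Integrable (compIncrement N μ m s t) P := by
  have h := ((hN.martingale_compensated m).integrable t).sub
    ((hN.martingale_compensated m).integrable s)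
  refine h.congr (.of_forall fun ω => ?_)
  simp only [Pi.sub_apply, compIncrement, increment]
  ring

theorem condExp_compIncrement (m : Fin M) {s t : ℝ≥0} (hst : s ≤ t) :
    P[compIncrement N μ m s t | hN.history s] =ᵐ[P] 0 := by
  have hm := hN.martingale_compensated m
  have heq : compIncrement N μ m s t =
      (fun ω => counts N t ω m - μ m * t) - fun ω => counts N s ω m - μ m * s := by
    ext ω
    simp only [Pi.sub_apply, compIncrement, increment]
    ring
  rw [heq]
  filter_upwards [condExp_sub (hm.integrable t) (hm.integrable s) (hN.history s),
    hm.condExp_ae_eq hst, hm.condExp_ae_eq le_rfl (i := s)] with ω h1 h2 h3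
  rw [h1, Pi.sub_apply, h2, h3, sub_self, Pi.zero_apply]

variable [IsProbabilityMeasure P]

theorem integrable_increment (m : Fin M) (s t : ℝ≥0) : Integrable (increment N m s t) P := by
  refine ((hN.integrable_compIncrement m s t).add (integrable_const (μ m * (t - s)))).congr
    (.of_forall fun ω => ?_)
  simp [compIncrement]

theorem integral_mul_compIncrement (m : Fin M) {s t : ℝ≥0} (hst : s ≤ t) {Y : Ω → ℝ}
    (hY : StronglyMeasurable[hN.history s] Y)
    (hint : Integrable (fun ω => Y ω * compIncrement N μ m s t ω) P) :
    ∫ ω, Y ω * compIncrement N μ m s t ω ∂P = 0 := by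
  have h := condExp_mul_of_stronglyMeasurable_left hY hint (hN.integrable_compIncrement m s t)
  change ∫ ω, (Y * compIncrement N μ m s t) ω ∂P = 0
  rw [← integral_condExp (hN.history.le s)]
  refine integral_eq_zero_of_ae ?_
  filter_upwards [h, hN.condExp_compIncrement m hst] with ω h1 h2
  rw [h1, Pi.mul_apply, h2, Pi.zero_apply, mul_zero]

/-- By the martingale property, the measure with density the increment and the measure `μ_m (t - s)
P` agree on `ℋ_s`. Working in `ENNReal` avoids any integrability of `Y`, so this is available before
moments are known. -/
theorem lintegral_mul_increment {m : Fin M} (hμ : 0 < μ m) {s t : ℝ≥0} (hst : s ≤ t)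
    {Y : Ω → ENNReal} (hY : Measurable[hN.history s] Y) :
    ∫⁻ ω, Y ω * ENNReal.ofReal (increment N m s t ω) ∂P =
      ENNReal.ofReal (μ m * (t - s)) * ∫⁻ ω, Y ω ∂P := by
  have hle := hN.history.le s
  have hmeas : Measurable fun ω => ENNReal.ofReal (increment N m s t ω) :=
    ((hN.stronglyMeasurable_increment m hst le_rfl).mono
      (hN.history.le t)).measurable.ennreal_ofReal
  have htrim : (P.withDensity fun ω => ENNReal.ofReal (increment N m s t ω)).trim hle =
      (ENNReal.ofReal (μ m * (t - s)) • P).trim hle := by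
    refine @Measure.ext _ (hN.history s) _ _ fun B hB => ?_
    rw [trim_measurableSet_eq hle hB, trim_measurableSet_eq hle hB,
      withDensity_apply _ (hle B hB), Measure.smul_apply, smul_eq_mul,
      ← ofReal_integral_eq_lintegral_ofReal (hN.integrable_increment m s t).restrict
        (.of_forall fun ω => increment_nonneg N m hst ω)]
    have h0 : ∫ ω in B, compIncrement N μ m s t ω ∂P = 0 := by
      rw [← setIntegral_condExp hle (hN.integrable_compIncrement m s t) hB]
      exact integral_eq_zero_of_ae (ae_restrict_of_ae (hN.condExp_compIncrement m hst))
    have h1 : ∫ ω in B, increment N m s t ω ∂P = μ m * (t - s) * P.real B := by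
      simp only [compIncrement] at h0
      rw [integral_sub (hN.integrable_increment m s t).restrict (integrable_const _),
        setIntegral_const, smul_eq_mul] at h0
      linarith
    rw [h1, ENNReal.ofReal_mul (mul_nonneg hμ.le (sub_nonneg.2 (by exact_mod_cast hst))),
      ofReal_measureReal]
  have hYm : Measurable Y := hY.mono hle le_rfl
  calc ∫⁻ ω, Y ω * ENNReal.ofReal (increment N m s t ω) ∂P
      = ∫⁻ ω, Y ω ∂(P.withDensity fun ω => ENNReal.ofReal (increment N m s t ω)) := by
        rw [lintegral_withDensity_eq_lintegral_mul _ hmeas hYm]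
        simp only [Pi.mul_apply, mul_comm]
    _ = ∫⁻ ω, Y ω ∂(ENNReal.ofReal (μ m * (t - s)) • P) := by
        rw [← lintegral_trim hle hY, htrim, lintegral_trim hle hY]
    _ = _ := lintegral_smul_measure _ _

/-! ### Moments of the counting processes -/

/-- The first `n` factors are known at time `n * h`, and the last one has conditional mean `1 + μ_m
h`. -/
theorem lintegral_prod_one_add_increment {m : Fin M} (hμ : 0 < μ m) (h : ℝ≥0) (n : ℕ) :
    ∫⁻ ω, ∏ j ∈ Finset.range n,
      (1 + ENNReal.ofReal (increment N m (j * h) ((j + 1 : ℕ) * h) ω)) ∂P =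
      (1 + ENNReal.ofReal (μ m * h)) ^ n := by
  have hmono : ∀ i j : ℕ, i ≤ j → (i : ℝ≥0) * h ≤ j * h := fun i j hij => by gcongr
  have hmeas : ∀ n : ℕ, Measurable[hN.history (n * h)] fun ω => ∏ j ∈ Finset.range n,
      (1 + ENNReal.ofReal (increment N m (j * h) ((j + 1 : ℕ) * h) ω)) := fun n => by
    refine Finset.measurable_prod _ fun j hj => Measurable.const_add ?_ _
    rw [Finset.mem_range] at hj
    exact (hN.stronglyMeasurable_increment m (hmono _ _ hj.le)
      (hmono _ _ hj)).measurable.ennreal_ofReal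
  induction n with
  | zero => simp
  | succ n ih =>
    simp only [Finset.prod_range_succ, mul_add, mul_one]
    rw [lintegral_add_left ((hmeas n).mono (hN.history.le _) le_rfl),
      hN.lintegral_mul_increment hμ (hmono n (n + 1) n.le_succ) (hmeas n), ih, pow_succ, mul_add,
      mul_one, mul_comm (ENNReal.ofReal _)]
    congr 3
    push_cast
    ring

/-- On a fine grid each increment is `0` or `1`, so the product of `1 + increment` equals `2 ^
N_m(T)`. Fatou's lemma and `(1 + x/n)^n ≤ e^x` give the bound. -/
theorem lintegral_two_pow_count_le {m : Fin M} (hμ : 0 < μ m) (T : ℝ≥0) :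
    ∫⁻ ω, 2 ^ (N ω).count m T ∂P ≤ ENNReal.ofReal (Real.exp (μ m * T)) := by
  set F : ℕ → Ω → ENNReal := fun n ω => ∏ j ∈ Finset.range (n + 1), (1 + ENNReal.ofReal
    (increment N m (j * (T / (n + 1 : ℕ))) ((j + 1 : ℕ) * (T / (n + 1 : ℕ))) ω)) with hF
  have hFm : ∀ n, Measurable (F n) := fun n => by
    refine Finset.measurable_prod _ fun j _ => Measurable.const_add ?_ _
    exact ((hN.stronglyMeasurable_increment m (le_max_left _ _)
      (le_max_right _ _)).mono (hN.history.le _)).measurable.ennreal_ofReal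
  have hlim : ∀ ω, Tendsto (fun n => F n ω) atTop (𝓝 (2 ^ (N ω).count m T)) := by
    intro ω
    -- For fixed `ω` the sequence is eventually constant.
    refine tendsto_const_nhds.congr' ?_
    filter_upwards [eventually_increment_mul_increment N 0 T ω] with n hn
    have key : ∀ k ≤ n + 1, ∏ j ∈ Finset.range k, (1 + ENNReal.ofReal
        (increment N m (j * (T / (n + 1 : ℕ))) ((j + 1 : ℕ) * (T / (n + 1 : ℕ))) ω)) =
        2 ^ (N ω).count m (k * (T / (n + 1 : ℕ)) : ℝ≥0) := by
      intro k
      induction k with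
      | zero => simp [Realization.count_zero]
      | succ k ih =>
        intro hk
        rw [Finset.prod_range_succ, ih (by omega)]
        -- The increment equals its own square, hence is `0` or `1`.
        have h1 := hn k hk m m
        simp only [zero_add, if_true] at h1
        have h2 : increment N m (k * (T / (n + 1 : ℕ))) ((k + 1 : ℕ) * (T / (n + 1 : ℕ))) ω = 0 ∨
            increment N m (k * (T / (n + 1 : ℕ))) ((k + 1 : ℕ) * (T / (n + 1 : ℕ))) ω = 1 := by
          rcases eq_or_ne (increment N m (k * (T / (n + 1 : ℕ)))
            ((k + 1 : ℕ) * (T / (n + 1 : ℕ))) ω) 0 with h | h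
          · exact .inl h
          · exact .inr (mul_left_cancel₀ h (h1.trans (mul_one _).symm))
        rcases h2 with h2 | h2
        · have h3 : (N ω).count m ((k + 1 : ℕ) * (T / (n + 1 : ℕ)) : ℝ≥0) =
              (N ω).count m (k * (T / (n + 1 : ℕ)) : ℝ≥0) := by
            rw [increment, counts, counts, sub_eq_zero] at h2
            exact_mod_cast h2
          rw [h2, h3]
          simp
        · have h3 : (N ω).count m ((k + 1 : ℕ) * (T / (n + 1 : ℕ)) : ℝ≥0) =
              (N ω).count m (k * (T / (n + 1 : ℕ)) : ℝ≥0) + 1 := by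
            rw [increment, counts, counts, sub_eq_iff_eq_add'] at h2
            exact_mod_cast h2
          rw [h2, h3, pow_succ]
          norm_num
    have hT : ((n + 1 : ℕ) : ℝ≥0) * (T / (n + 1 : ℕ)) = T := mul_div_cancel₀ _ (by positivity)
    rw [hF]
    exact ((key (n + 1) le_rfl).trans (by rw [hT])).symm
  calc ∫⁻ ω, 2 ^ (N ω).count m T ∂P = ∫⁻ ω, liminf (fun n => F n ω) atTop ∂P :=
        lintegral_congr fun ω => (hlim ω).liminf_eq.symm
    _ ≤ liminf (fun n => ∫⁻ ω, F n ω ∂P) atTop := lintegral_liminf_le hFm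
    _ ≤ ENNReal.ofReal (Real.exp (μ m * T)) := by
        refine liminf_le_of_le (by isBoundedDefault) fun b hb => ?_
        obtain ⟨n, hn⟩ := hb.exists
        refine hn.trans ?_
        rw [hF, hN.lintegral_prod_one_add_increment hμ]
        rw [← ENNReal.ofReal_one, ← ENNReal.ofReal_add zero_le_one (by positivity),
          ← ENNReal.ofReal_pow (by positivity)]
        refine ENNReal.ofReal_le_ofReal ?_
        calc (1 + μ m * ((T / (n + 1 : ℕ) : ℝ≥0) : ℝ)) ^ (n + 1)
            ≤ Real.exp (μ m * ((T / (n + 1 : ℕ) : ℝ≥0) : ℝ)) ^ (n + 1) := by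
              refine pow_le_pow_left₀ (by positivity) ?_ _
              linarith [Real.add_one_le_exp (μ m * ((T / (n + 1 : ℕ) : ℝ≥0) : ℝ))]
          _ = Real.exp (μ m * T) := by
              rw [← Real.exp_nat_mul]
              congr 1
              push_cast
              field_simp

/-- The exponential moment `E[2^N]` controls every power through `x^p / p! ≤ e^x` with `x = N log
2`. -/
theorem hasMoments_counts {m : Fin M} (hμ : 0 < μ m) (T : ℝ≥0) :
    HasMoments (fun ω => counts N T ω m) P := by
  have hm : Measurable fun ω => counts N T ω m := by
    simpa [← increment_zero_left] using ((hN.stronglyMeasurable_increment m (zero_le (a := T))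
      le_rfl).mono (hN.history.le T)).measurable
  have hexp : ∀ ω, Real.exp (Real.log 2 * counts N T ω m) = 2 ^ (N ω).count m T := fun ω => by
    rw [counts, mul_comm, Real.exp_nat_mul, Real.exp_log two_pos]
  have hint : Integrable (fun ω => Real.exp (Real.log 2 * counts N T ω m)) P := by
    refine ⟨(Real.measurable_exp.comp (hm.const_mul _)).aestronglyMeasurable, ?_⟩
    rw [hasFiniteIntegral_iff_ofReal (.of_forall fun ω => (Real.exp_pos _).le)]
    refine lt_of_le_of_lt ?_ (lt_of_le_of_lt (hN.lintegral_two_pow_count_le hμ T)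
      ENNReal.ofReal_lt_top)
    refine lintegral_mono fun ω => ?_
    rw [hexp, ENNReal.ofReal_pow zero_le_two, ENNReal.ofReal_ofNat]
  intro p
  rcases Nat.eq_zero_or_pos p with rfl | hp
  · simpa using hm.aestronglyMeasurable
  rw [← integrable_norm_rpow_iff hm.aestronglyMeasurable (by exact_mod_cast hp.ne')
    (ENNReal.natCast_ne_top p)]
  have hlog : 0 < Real.log 2 := Real.log_pos one_lt_two
  refine (hint.const_mul (p.factorial / Real.log 2 ^ p)).mono'
    (hm.norm.pow_const _).aestronglyMeasurable (.of_forall fun ω => ?_)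
  have hc : 0 ≤ counts N T ω m := Nat.cast_nonneg _
  rw [ENNReal.toReal_natCast, Real.rpow_natCast, Real.norm_of_nonneg (by positivity),
    Real.norm_of_nonneg hc]
  have h := Real.pow_div_factorial_le_exp _ (mul_nonneg hlog.le hc) p
  rw [div_le_iff₀ (by positivity), mul_pow] at h
  rw [div_mul_eq_mul_div, le_div_iff₀ (by positivity)]
  linarith

theorem hasMoments_increment {m : Fin M} (hμ : 0 < μ m) (s t : ℝ≥0) :
    HasMoments (increment N m s t) P :=
  (hN.hasMoments_counts hμ t).sub (hN.hasMoments_counts hμ s)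

theorem hasMoments_compIncrement {m : Fin M} (hμ : 0 < μ m) (s t : ℝ≥0) :
    HasMoments (compIncrement N μ m s t) P :=
  (hN.hasMoments_increment hμ s t).sub (.const _)

end IsHawkes

end Hawkes

/-! ### Quadratic covariation and the discrete Itô isometry. -/

namespace Hawkes

variable {M : ℕ} {Ω : Type*}

theorem compIncrement_add (N : Ω → Realization M) (μ : Fin M → ℝ) (m : Fin M) (r s t : ℝ≥0)
    (ω : Ω) :
    compIncrement N μ m r s ω + compIncrement N μ m s t ω = compIncrement N μ m r t ω := by
  simp only [compIncrement, increment]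
  ring

theorem abs_compIncrement_le (N : Ω → Realization M) {μ : Fin M → ℝ} {m : Fin M} (hμ : 0 < μ m)
    {s t : ℝ≥0} (hst : s ≤ t) (ω : Ω) :
    |compIncrement N μ m s t ω| ≤ increment N m s t ω + μ m * (t - s) := by
  have h1 := increment_nonneg N m hst ω
  have h2 : 0 ≤ μ m * ((t : ℝ) - s) := mul_nonneg hμ.le (sub_nonneg.2 (by exact_mod_cast hst))
  rw [compIncrement, abs_le]
  constructor <;> linarith

theorem increment_le_increment (N : Ω → Realization M) (m : Fin M) {s s' t' t : ℝ≥0}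
    (hs : s ≤ s') (ht : t' ≤ t) (ω : Ω) : increment N m s' t' ω ≤ increment N m s t ω := by
  have h1 : counts N s ω m ≤ counts N s' ω m :=
    Nat.cast_le.2 ((N ω).count_mono m (NNReal.coe_le_coe.2 hs))
  have h2 : counts N t' ω m ≤ counts N t ω m :=
    Nat.cast_le.2 ((N ω).count_mono m (NNReal.coe_le_coe.2 ht))
  simp only [increment]
  linarith

/-- The sum over a grid of products of compensated increments. -/
noncomputable def bracket (N : Ω → Realization M) (μ : Fin M → ℝ) (q q' : Fin M) (s h : ℝ≥0)
    (n : ℕ) (ω : Ω) : ℝ :=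
  ∑ j ∈ Finset.range n, compIncrement N μ q (s + j * h) (s + (j + 1 : ℕ) * h) ω *
    compIncrement N μ q' (s + j * h) (s + (j + 1 : ℕ) * h) ω

theorem grid_le_grid (s h : ℝ≥0) {i j : ℕ} (hij : i ≤ j) : s + (i : ℝ≥0) * h ≤ s + j * h := by
  gcongr

/-- In each product one factor is bounded by its total over the grid. The bound involves the grid
only through `n * h`, so it dominates all refinements at once. -/
theorem abs_bracket_le (N : Ω → Realization M) {μ : Fin M → ℝ} (hμ : ∀ m, 0 < μ m) (q q' : Fin M)
    (s h : ℝ≥0) (n : ℕ) (ω : Ω) :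
    |bracket N μ q q' s h n ω| ≤ (increment N q s (s + n * h) ω + μ q * (n * h)) *
      (increment N q' s (s + n * h) ω + μ q' * (n * h)) := by
  have hstep : ∀ j : ℕ, ((s + (j + 1 : ℕ) * h : ℝ≥0) : ℝ) - (s + j * h : ℝ≥0) = h := fun j => by
    push_cast
    ring
  have hsum : ∑ j ∈ Finset.range n,
      (increment N q (s + j * h) (s + (j + 1 : ℕ) * h) ω + μ q * h) =
      increment N q s (s + n * h) ω + μ q * (n * h) := by
    rw [Finset.sum_add_distrib, sum_increment]
    simp
    ring
  rw [← hsum, Finset.sum_mul]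
  refine (Finset.abs_sum_le_sum_abs _ _).trans (Finset.sum_le_sum fun j hj => ?_)
  have hjn : j + 1 ≤ n := Finset.mem_range.1 hj
  have h1 := abs_compIncrement_le N (hμ q) (grid_le_grid s h j.le_succ) ω
  have h2 := abs_compIncrement_le N (hμ q') (grid_le_grid s h j.le_succ) ω
  rw [hstep] at h1 h2
  rw [abs_mul]
  refine mul_le_mul h1 (h2.trans (add_le_add ?_ ?_)) (abs_nonneg _) ((abs_nonneg _).trans h1)
  · exact increment_le_increment N q' (by simp) (grid_le_grid s h hjn) ω
  · have : (1 : ℝ) * h ≤ n * h := by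
      gcongr
      exact_mod_cast (by omega : 1 ≤ n)
    rw [one_mul] at this
    exact mul_le_mul_of_nonneg_left this (hμ q').le

/-- This is `[M_q, M_q'] = δ_{qq'} N_q`, path by path: on a fine grid products of counting
increments reduce to the increment itself or to `0`, and every term involving the drift carries a
factor of the mesh. -/
theorem tendsto_bracket (N : Ω → Realization M) (μ : Fin M → ℝ) (q q' : Fin M) (s L : ℝ≥0)
    (ω : Ω) :
    Tendsto (fun n : ℕ => bracket N μ q q' s (L / (n + 1 : ℕ)) (n + 1) ω) atTop
      (𝓝 (if q = q' then increment N q s (s + L) ω else 0)) := by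
  have hlim : Tendsto (fun n : ℕ => (L : ℝ) / ((n + 1 : ℕ) : ℝ)) atTop (𝓝 0) :=
    (tendsto_const_div_atTop_nhds_zero_nat (L : ℝ)).comp (tendsto_add_atTop_nat 1)
  have h := (hlim.const_mul (μ q * μ q' * L - μ q' * increment N q s (s + L) ω -
    μ q * increment N q' s (s + L) ω)).const_add
      (if q = q' then increment N q s (s + L) ω else 0)
  rw [mul_zero, add_zero] at h
  refine h.congr' ?_
  filter_upwards [eventually_increment_mul_increment N s L ω] with n hn
  set h' : ℝ≥0 := L / (n + 1 : ℕ) with hh'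
  have hL : ((n + 1 : ℕ) : ℝ≥0) * h' = L := mul_div_cancel₀ _ (by positivity)
  have hL' : ((n + 1 : ℕ) : ℝ) * h' = L := by exact_mod_cast hL
  have hcast : (L : ℝ) / ((n + 1 : ℕ) : ℝ) = h' := by rw [hh']; push_cast; rfl
  have hterm : ∀ j ∈ Finset.range (n + 1),
      compIncrement N μ q (s + j * h') (s + (j + 1 : ℕ) * h') ω *
        compIncrement N μ q' (s + j * h') (s + (j + 1 : ℕ) * h') ω =
      (if q = q' then increment N q (s + j * h') (s + (j + 1 : ℕ) * h') ω else 0)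
        - μ q' * h' * increment N q (s + j * h') (s + (j + 1 : ℕ) * h') ω
        - μ q * h' * increment N q' (s + j * h') (s + (j + 1 : ℕ) * h') ω
        + μ q * μ q' * h' * h' := fun j hj => by
    have hstep : ((s + (j + 1 : ℕ) * h' : ℝ≥0) : ℝ) - (s + j * h' : ℝ≥0) = h' := by
      push_cast
      ring
    rw [← hn j (Finset.mem_range.1 hj) q q', compIncrement, compIncrement, hstep]
    ring
  have hdiag : ∑ j ∈ Finset.range (n + 1),
      (if q = q' then increment N q (s + j * h') (s + (j + 1 : ℕ) * h') ω else 0) =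
      if q = q' then increment N q s (s + L) ω else 0 := by
    split_ifs
    · rw [sum_increment, hL]
    · simp
  rw [bracket, Finset.sum_congr rfl hterm, Finset.sum_add_distrib, Finset.sum_sub_distrib,
    Finset.sum_sub_distrib, hdiag, ← Finset.mul_sum, ← Finset.mul_sum, sum_increment,
    sum_increment, hL, hcast, Finset.sum_const, Finset.card_range, nsmul_eq_mul, ← hL']
  ring

/-- The sum `∑_{j < n} Y_j (M_q((j+1)h) - M_q(jh))`, for `M_q(t) = N_q(t) - μ_q t`. -/
noncomputable def discreteIntegral (N : Ω → Realization M) (μ : Fin M → ℝ) (q : Fin M) (h : ℝ≥0)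
    (Y : ℕ → Ω → ℝ) (n : ℕ) (ω : Ω) : ℝ :=
  ∑ j ∈ Finset.range n, Y j ω * compIncrement N μ q (j * h) ((j + 1 : ℕ) * h) ω

namespace IsHawkes

variable [MeasurableSpace Ω] {P : Measure Ω} {N : Ω → Realization M} {μ : Fin M → ℝ} {β : ℝ}

theorem stronglyMeasurable_discreteIntegral (hN : IsHawkes P N μ β 0) (q : Fin M) (h : ℝ≥0)
    {Y : ℕ → Ω → ℝ}
    (hY : ∀ j : ℕ, StronglyMeasurable[hN.history (j * h)] (Y j)) (n : ℕ) :
    StronglyMeasurable[hN.history (n * h)] (discreteIntegral N μ q h Y n) := by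
  refine Finset.stronglyMeasurable_fun_sum _ fun j hj => ?_
  have hjn : j + 1 ≤ n := Finset.mem_range.1 hj
  have h1 : ((j : ℕ) : ℝ≥0) * h ≤ n * h := by
    gcongr
    exact (Nat.le_succ j).trans hjn
  have h2 : ((j + 1 : ℕ) : ℝ≥0) * h ≤ n * h := by gcongr
  exact ((hY j).mono (hN.history.mono h1)).mul (hN.stronglyMeasurable_compIncrement q h1 h2)

variable [IsProbabilityMeasure P] (hN : IsHawkes P N μ β 0) (hμ : ∀ m, 0 < μ m)

include hN hμ

theorem integral_mul_compIncrement_eq_zero (q : Fin M) {s t : ℝ≥0} (hst : s ≤ t) {Y : Ω → ℝ}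
    (hY : StronglyMeasurable[hN.history s] Y) (hYm : HasMoments Y P) :
    ∫ ω, Y ω * compIncrement N μ q s t ω ∂P = 0 :=
  hN.integral_mul_compIncrement q hst hY
    (hYm.mul (hN.hasMoments_compIncrement (hμ q) s t)).integrable

theorem integral_mul_increment (q : Fin M) {s t : ℝ≥0} (hst : s ≤ t) {Y : Ω → ℝ}
    (hY : StronglyMeasurable[hN.history s] Y) (hYm : HasMoments Y P) :
    ∫ ω, Y ω * increment N q s t ω ∂P = μ q * (t - s) * ∫ ω, Y ω ∂P := by
  have h0 := hN.integral_mul_compIncrement_eq_zero hμ q hst hY hYm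
  simp only [compIncrement, mul_sub (Y _)] at h0
  rw [integral_sub (hYm.mul (hN.hasMoments_increment (hμ q) s t)).integrable
    (by simpa only [mul_comm] using (hYm.const_mul (μ q * (t - s))).integrable),
    integral_mul_const] at h0
  linarith

theorem hasMoments_bracket (q q' : Fin M) (s h : ℝ≥0) (n : ℕ) :
    HasMoments (bracket N μ q q' s h n) P :=
  .sum _ fun _ _ => (hN.hasMoments_compIncrement (hμ q) _ _).mul
    (hN.hasMoments_compIncrement (hμ q') _ _)

/-- Orthogonality of martingale increments: in the expanded product, terms from two different grid
intervals have mean zero. The identity is exact for every grid. -/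
theorem integral_mul_compIncrement_mul_eq_integral_mul_bracket (q q' : Fin M) (s h : ℝ≥0)
    {G : Ω → ℝ} (hG : StronglyMeasurable[hN.history s] G) (hGm : HasMoments G P) (n : ℕ) :
    ∫ ω, G ω * (compIncrement N μ q s (s + n * h) ω * compIncrement N μ q' s (s + n * h) ω) ∂P =
      ∫ ω, G ω * bracket N μ q q' s h n ω ∂P := by
  induction n with
  | zero => simp [bracket, compIncrement, increment]
  | succ n ih =>
    have hle : s ≤ s + n * h := by simp
    have hM := fun (m : Fin M) (a b : ℝ≥0) => hN.hasMoments_compIncrement (hμ m) a b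
    have hst := grid_le_grid s h n.le_succ
    have hGs : StronglyMeasurable[hN.history (s + n * h)] G := hG.mono (hN.history.mono hle)
    have e1 : ∀ ω, G ω * (compIncrement N μ q s (s + (n + 1 : ℕ) * h) ω *
        compIncrement N μ q' s (s + (n + 1 : ℕ) * h) ω) =
        G ω * (compIncrement N μ q s (s + n * h) ω * compIncrement N μ q' s (s + n * h) ω)
        + G ω * compIncrement N μ q s (s + n * h) ω *
          compIncrement N μ q' (s + n * h) (s + (n + 1 : ℕ) * h) ω
        + G ω * compIncrement N μ q' s (s + n * h) ω *
          compIncrement N μ q (s + n * h) (s + (n + 1 : ℕ) * h) ω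
        + G ω * (compIncrement N μ q (s + n * h) (s + (n + 1 : ℕ) * h) ω *
          compIncrement N μ q' (s + n * h) (s + (n + 1 : ℕ) * h) ω) := fun ω => by
      rw [← compIncrement_add N μ q s (s + n * h), ← compIncrement_add N μ q' s (s + n * h)]
      ring
    have e2 : ∀ ω, G ω * bracket N μ q q' s h (n + 1) ω = G ω * bracket N μ q q' s h n ω +
        G ω * (compIncrement N μ q (s + n * h) (s + (n + 1 : ℕ) * h) ω *
          compIncrement N μ q' (s + n * h) (s + (n + 1 : ℕ) * h) ω) := fun ω => by
      rw [bracket, Finset.sum_range_succ, mul_add]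
      rfl
    have i1 := (hGm.mul ((hM q s (s + n * h)).mul (hM q' s (s + n * h))))
    have i2 := ((hGm.mul (hM q s (s + n * h))).mul
      (hM q' (s + n * h) (s + (n + 1 : ℕ) * h)))
    have i3 := ((hGm.mul (hM q' s (s + n * h))).mul
      (hM q (s + n * h) (s + (n + 1 : ℕ) * h)))
    have i4 := (hGm.mul ((hM q (s + n * h) (s + (n + 1 : ℕ) * h)).mul
      (hM q' (s + n * h) (s + (n + 1 : ℕ) * h))))
    simp only [e1, e2]
    rw [integral_add ((i1.add i2).add i3).integrable i4.integrable,
      integral_add (i1.add i2).integrable i3.integrable, integral_add i1.integrable i2.integrable,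
      integral_add (hGm.mul (hN.hasMoments_bracket hμ q q' s h n)).integrable i4.integrable, ih,
      hN.integral_mul_compIncrement_eq_zero hμ q' hst
        (Y := fun ω => G ω * compIncrement N μ q s (s + n * h) ω)
        (hGs.mul (hN.stronglyMeasurable_compIncrement q hle le_rfl)) (hGm.mul (hM q s _)),
      hN.integral_mul_compIncrement_eq_zero hμ q hst
        (Y := fun ω => G ω * compIncrement N μ q' s (s + n * h) ω)
        (hGs.mul (hN.stronglyMeasurable_compIncrement q' hle le_rfl)) (hGm.mul (hM q' s _)),
      add_zero, add_zero]

/-- The compensated counting processes have conditional covariance `δ_{q,q'} μ_q dt`. -/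
theorem integral_mul_compIncrement_mul_compIncrement (q q' : Fin M) {s t : ℝ≥0} (hst : s ≤ t)
    {G : Ω → ℝ} (hG : StronglyMeasurable[hN.history s] G) (hGm : HasMoments G P) :
    ∫ ω, G ω * (compIncrement N μ q s t ω * compIncrement N μ q' s t ω) ∂P =
      if q = q' then μ q * (t - s) * ∫ ω, G ω ∂P else 0 := by
  obtain ⟨L, rfl⟩ := exists_add_of_le hst
  have hgrid : ∀ n : ℕ, ((n + 1 : ℕ) : ℝ≥0) * (L / (n + 1 : ℕ)) = L := fun n =>
    mul_div_cancel₀ _ (by positivity)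
  have hgrid' : ∀ n : ℕ, ((n + 1 : ℕ) : ℝ) * ((L / (n + 1 : ℕ) : ℝ≥0) : ℝ) = L := fun n => by
    exact_mod_cast hgrid n
  -- The left side does not depend on `n`, so it equals the limit of the right side.
  have hconst : ∀ n : ℕ,
      ∫ ω, G ω * (compIncrement N μ q s (s + L) ω * compIncrement N μ q' s (s + L) ω) ∂P =
      ∫ ω, G ω * bracket N μ q q' s (L / (n + 1 : ℕ)) (n + 1) ω ∂P := fun n => by
    rw [← hN.integral_mul_compIncrement_mul_eq_integral_mul_bracket hμ q q' s _ hG hGm, hgrid]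
  have hB := fun m => (hN.hasMoments_increment (hμ m) s (s + L)).add (.const (μ m * L))
  have hlim := tendsto_integral_of_dominated_convergence
    (F := fun (n : ℕ) ω => G ω * bracket N μ q q' s (L / (n + 1 : ℕ)) (n + 1) ω)
    (f := fun ω => G ω * if q = q' then increment N q s (s + L) ω else 0)
    (fun ω => |G ω| * ((increment N q s (s + L) ω + μ q * L) *
      (increment N q' s (s + L) ω + μ q' * L))) (μ := P)
    (fun n => (hGm.mul (hN.hasMoments_bracket hμ q q' s _ _)).integrable.aestronglyMeasurable)
    (((HasMoments.mul (fun p => (hGm p).abs) ((hB q).mul (hB q'))).integrable))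
    (fun n => .of_forall fun ω => by
      have h := abs_bracket_le N hμ q q' s (L / (n + 1 : ℕ)) (n + 1) ω
      rw [hgrid, hgrid'] at h
      rw [Real.norm_eq_abs, abs_mul]
      gcongr)
    (.of_forall fun ω => (tendsto_bracket N μ q q' s L ω).const_mul _)
  simp only [← hconst] at hlim
  rw [tendsto_nhds_unique tendsto_const_nhds hlim]
  split_ifs
  · exact hN.integral_mul_increment hμ q hst hG hGm
  · simp

theorem hasMoments_discreteIntegral (q : Fin M) (h : ℝ≥0) {Y : ℕ → Ω → ℝ}
    (hYm : ∀ j, HasMoments (Y j) P) (n : ℕ) : HasMoments (discreteIntegral N μ q h Y n) P :=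
  .sum _ fun j _ => (hYm j).mul (hN.hasMoments_compIncrement (hμ q) _ _)

theorem integral_discreteIntegral (q : Fin M) (h : ℝ≥0) {Y : ℕ → Ω → ℝ}
    (hY : ∀ j : ℕ, StronglyMeasurable[hN.history (j * h)] (Y j))
    (hYm : ∀ j, HasMoments (Y j) P) (n : ℕ) : ∫ ω, discreteIntegral N μ q h Y n ω ∂P = 0 := by
  simp only [discreteIntegral]
  rw [integral_finsetSum _ fun j _ =>
    ((hYm j).mul (hN.hasMoments_compIncrement (hμ q) _ _)).integrable]
  refine Finset.sum_eq_zero fun j _ => ?_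
  exact hN.integral_mul_compIncrement_eq_zero hμ q (by gcongr; simp) (hY j) (hYm j)

/-- The Itô isometry for adapted step functions. -/
theorem integral_discreteIntegral_mul_discreteIntegral (q q' : Fin M) (h : ℝ≥0)
    {Y Y' : ℕ → Ω → ℝ} (hY : ∀ j : ℕ, StronglyMeasurable[hN.history (j * h)] (Y j))
    (hYm : ∀ j, HasMoments (Y j) P)
    (hY' : ∀ j : ℕ, StronglyMeasurable[hN.history (j * h)] (Y' j))
    (hYm' : ∀ j, HasMoments (Y' j) P) (n : ℕ) :
    ∫ ω, discreteIntegral N μ q h Y n ω * discreteIntegral N μ q' h Y' n ω ∂P =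
      if q = q' then μ q * h * ∑ j ∈ Finset.range n, ∫ ω, Y j ω * Y' j ω ∂P else 0 := by
  induction n with
  | zero => simp [discreteIntegral]
  | succ n ih =>
    have hst : ((n : ℕ) : ℝ≥0) * h ≤ (n + 1 : ℕ) * h := by
      gcongr
      simp
    have hstep : (((n + 1 : ℕ) * h : ℝ≥0) : ℝ) - (n * h : ℝ≥0) = h := by
      push_cast
      ring
    -- The two mixed terms are an `ℋ_{nh}`-measurable factor times a compensated increment after
    -- `nh`, so they integrate to zero. The last term is evaluated by the conditional covariance.
    have e1 : ∀ ω, discreteIntegral N μ q h Y (n + 1) ω * discreteIntegral N μ q' h Y' (n + 1) ω =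
        discreteIntegral N μ q h Y n ω * discreteIntegral N μ q' h Y' n ω
        + discreteIntegral N μ q h Y n ω * Y' n ω *
          compIncrement N μ q' (n * h) ((n + 1 : ℕ) * h) ω
        + discreteIntegral N μ q' h Y' n ω * Y n ω *
          compIncrement N μ q (n * h) ((n + 1 : ℕ) * h) ω
        + Y n ω * Y' n ω * (compIncrement N μ q (n * h) ((n + 1 : ℕ) * h) ω *
          compIncrement N μ q' (n * h) ((n + 1 : ℕ) * h) ω) := fun ω => by
      simp only [discreteIntegral, Finset.sum_range_succ]
      ring
    have hI := hN.hasMoments_discreteIntegral hμ q h hYm n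
    have hI' := hN.hasMoments_discreteIntegral hμ q' h hYm' n
    have hIs := hN.stronglyMeasurable_discreteIntegral q h hY n
    have hIs' := hN.stronglyMeasurable_discreteIntegral q' h hY' n
    have hM := fun m => hN.hasMoments_compIncrement (hμ m) (n * h) ((n + 1 : ℕ) * h)
    have i1 := (hI.mul hI')
    have i2 := ((hI.mul (hYm' n)).mul (hM q'))
    have i3 := ((hI'.mul (hYm n)).mul (hM q))
    have i4 := (((hYm n).mul (hYm' n)).mul ((hM q).mul (hM q')))
    simp only [e1]
    rw [integral_add ((i1.add i2).add i3).integrable i4.integrable,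
      integral_add (i1.add i2).integrable i3.integrable, integral_add i1.integrable i2.integrable,
      ih, hN.integral_mul_compIncrement_eq_zero hμ q' hst
        (Y := fun ω => discreteIntegral N μ q h Y n ω * Y' n ω) (hIs.mul (hY' n)) (hI.mul (hYm' n)),
      hN.integral_mul_compIncrement_eq_zero hμ q hst
        (Y := fun ω => discreteIntegral N μ q' h Y' n ω * Y n ω) (hIs'.mul (hY n))
        (hI'.mul (hYm n)),
      hN.integral_mul_compIncrement_mul_compIncrement hμ q q' hst
        (G := fun ω => Y n ω * Y' n ω) ((hY n).mul (hY' n)) ((hYm n).mul (hYm' n)), hstep,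
      Finset.sum_range_succ]
    split_ifs <;> ring

end IsHawkes

end Hawkes

namespace Hawkes

/-! ### Limits of geometric sums -/

/-- The reciprocal of the difference quotient of `1 - e^{-βt}` at `0`; it handles the denominators
of the geometric sums. -/
theorem tendsto_div_one_sub_exp {β : ℝ} (hβ : 0 < β) {h : ℕ → ℝ} (hh : ∀ n, 0 < h n)
    (hlim : Tendsto h atTop (𝓝 0)) :
    Tendsto (fun n => h n / (1 - Real.exp (-β * h n))) atTop (𝓝 (1 / β)) := by
  have hd : HasDerivAt (fun t : ℝ => 1 - Real.exp (-β * t)) β 0 := by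
    have h1 := (((hasDerivAt_id (0 : ℝ)).const_mul (-β)).exp).const_sub 1
    simpa using h1
  have hs := hd.tendsto_slope_zero.comp (tendsto_nhdsWithin_iff.2
    ⟨hlim, .of_forall fun n => (hh n).ne'⟩)
  have hi := hs.inv₀ hβ.ne'
  rw [one_div]
  refine hi.congr fun n => ?_
  simp [div_eq_mul_inv, mul_comm]

theorem tendsto_exp_neg_mul {β : ℝ} {h : ℕ → ℝ} (hlim : Tendsto h atTop (𝓝 0)) :
    Tendsto (fun n => Real.exp (-β * h n)) atTop (𝓝 1) := by
  simpa [Function.comp_def] using (Real.continuous_exp.tendsto _).comp (hlim.const_mul (-β))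

theorem sum_range_pow_succ {r : ℝ} (hr : r ≠ 1) (j : ℕ) :
    ∑ l ∈ Finset.range j, r ^ (l + 1) = r * (1 - r ^ j) / (1 - r) := by
  have h1 : (1 : ℝ) - r ≠ 0 := sub_ne_zero.2 hr.symm
  have h2 := geom_sum_eq hr j
  simp only [pow_succ', ← Finset.mul_sum]
  rw [h2, mul_div_assoc, ← neg_sub 1 (r ^ j), ← neg_sub 1 r, neg_div_neg_eq]

theorem exp_neg_mul_ne_one {β h : ℝ} (hβ : 0 < β) (hh : 0 < h) : Real.exp (-β * h) ≠ 1 :=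
  (Real.exp_lt_one_iff.2 (by nlinarith)).ne

/-- The limit of the sums `h ∑_{j ≤ n} (1 - e^{-βhj})`, for `h = T / (n + 1)`. -/
theorem tendsto_sum_one_sub_pow {β T : ℝ} (hβ : 0 < β) (hT : 0 < T) :
    Tendsto (fun n : ℕ => T / (n + 1 : ℕ) * ∑ j ∈ Finset.range (n + 1),
      (1 - Real.exp (-β * (T / (n + 1 : ℕ))) ^ j)) atTop
      (𝓝 (T - (1 - Real.exp (-β * T)) / β)) := by
  set h : ℕ → ℝ := fun n => T / (n + 1 : ℕ) with hh
  have hpos : ∀ n, 0 < h n := fun n => by positivity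
  have hlim : Tendsto h atTop (𝓝 0) :=
    (tendsto_const_div_atTop_nhds_zero_nat T).comp (tendsto_add_atTop_nat 1)
  have hmul : ∀ n : ℕ, ((n + 1 : ℕ) : ℝ) * h n = T := fun n => mul_div_cancel₀ _ (by positivity)
  have key := ((tendsto_div_one_sub_exp hβ hpos hlim).mul_const
    (1 - Real.exp (-β * T))).const_sub T
  rw [one_div_mul_eq_div] at key
  refine key.congr fun n => ?_
  have hr := exp_neg_mul_ne_one hβ (hpos n)
  have hpow : Real.exp (-β * h n) ^ (n + 1) = Real.exp (-β * T) := by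
    rw [← Real.exp_nat_mul, ← hmul n]
    ring_nf
  have h1 : (1 : ℝ) - Real.exp (-β * h n) ≠ 0 := sub_ne_zero.2 hr.symm
  change _ = h n * _
  rw [Finset.sum_sub_distrib, geom_sum_eq hr, hpow, ← neg_sub 1 (Real.exp (-β * T)),
    ← neg_sub 1 (Real.exp (-β * h n)), neg_div_neg_eq, Finset.sum_const, Finset.card_range,
    nsmul_eq_mul, mul_one]
  linear_combination -hmul n

/-- The limit of the discretized integrals of `(1 - e^{-βt}) / β` over `[0, T]`. -/
theorem tendsto_sum_geom {β T : ℝ} (hβ : 0 < β) (hT : 0 < T) :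
    Tendsto (fun n : ℕ => T / (n + 1 : ℕ) * ∑ j ∈ Finset.range (n + 1),
      T / (n + 1 : ℕ) * ∑ l ∈ Finset.range j, Real.exp (-β * (T / (n + 1 : ℕ))) ^ (l + 1)) atTop
      (𝓝 (1 / β * (T - (1 - Real.exp (-β * T)) / β))) := by
  set h : ℕ → ℝ := fun n => T / (n + 1 : ℕ) with hh
  have hpos : ∀ n, 0 < h n := fun n => by positivity
  have hlim : Tendsto h atTop (𝓝 0) :=
    (tendsto_const_div_atTop_nhds_zero_nat T).comp (tendsto_add_atTop_nat 1)
  have key := ((tendsto_div_one_sub_exp hβ hpos hlim).mul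
    (tendsto_exp_neg_mul (β := β) hlim)).mul (tendsto_sum_one_sub_pow hβ hT)
  rw [mul_one] at key
  refine key.congr fun n => ?_
  change _ * (h n * _) = h n * ∑ j ∈ Finset.range (n + 1),
    h n * ∑ l ∈ Finset.range j, Real.exp (-β * h n) ^ (l + 1)
  simp only [sum_range_pow_succ (exp_neg_mul_ne_one hβ (hpos n)), Finset.mul_sum]
  exact Finset.sum_congr rfl fun j _ => by ring

/-- The limit of the discretized integrals of `((1 - e^{-βt}) / β) ^ 2` over `[0, T]`. -/
theorem tendsto_sum_geom_sq {β T : ℝ} (hβ : 0 < β) (hT : 0 < T) :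
    Tendsto (fun n : ℕ => T / (n + 1 : ℕ) * ∑ j ∈ Finset.range (n + 1),
      (T / (n + 1 : ℕ) *
        ∑ l ∈ Finset.range j, Real.exp (-β * (T / (n + 1 : ℕ))) ^ (l + 1)) ^ 2) atTop
      (𝓝 (1 / β ^ 2 * (T - 2 * ((1 - Real.exp (-β * T)) / β) +
        (1 - Real.exp (-(2 * β) * T)) / (2 * β)))) := by
  set h : ℕ → ℝ := fun n => T / (n + 1 : ℕ) with hh
  have hpos : ∀ n, 0 < h n := fun n => by positivity
  have hlim : Tendsto h atTop (𝓝 0) :=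
    (tendsto_const_div_atTop_nhds_zero_nat T).comp (tendsto_add_atTop_nat 1)
  -- The square is linearized by `(1 - r^j)² = 2(1 - r^j) - (1 - (r²)^j)`, where `r²` belongs to the
  -- rate `2β`.
  have key := (((tendsto_div_one_sub_exp hβ hpos hlim).mul
    (tendsto_exp_neg_mul (β := β) hlim)).pow 2).mul
    (((tendsto_sum_one_sub_pow hβ hT).const_mul 2).sub
      (tendsto_sum_one_sub_pow (mul_pos two_pos hβ) hT))
  rw [mul_one, div_pow, one_pow] at key
  convert key using 1
  · ext n
    change h n * ∑ j ∈ Finset.range (n + 1),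
      (h n * ∑ l ∈ Finset.range j, Real.exp (-β * h n) ^ (l + 1)) ^ 2 =
      _ * (2 * (h n * ∑ j ∈ Finset.range (n + 1), (1 - Real.exp (-β * h n) ^ j)) -
        h n * ∑ j ∈ Finset.range (n + 1), (1 - Real.exp (-(2 * β) * h n) ^ j))
    have h2 : Real.exp (-(2 * β) * h n) = Real.exp (-β * h n) ^ 2 := by
      rw [← Real.exp_nat_mul]
      push_cast
      ring_nf
    simp only [sum_range_pow_succ (exp_neg_mul_ne_one hβ (hpos n)), h2, Finset.mul_sum,
      ← Finset.sum_sub_distrib]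
    exact Finset.sum_congr rfl fun j _ => by ring
  · congr 1
    ring

/-! ### The discretized score -/

variable {M : ℕ} {Ω : Type*}

/-- The excitation `∑_{t_i ≤ jh, u_i = p} e^{-β(jh - t_i)}`, with the event times rounded down to
the grid of mesh `h`. -/
noncomputable def discreteExcitation (N : Ω → Realization M) (β : ℝ) (p : Fin M) (h : ℝ≥0) (j : ℕ)
    (ω : Ω) : ℝ :=
  ∑ i ∈ Finset.range j, Real.exp (-β * h) ^ (j - i) *
    increment N p (i * h) ((i + 1 : ℕ) * h) ω

theorem sum_range_reflect_pow (r : ℝ) (j : ℕ) :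
    ∑ i ∈ Finset.range j, r ^ (j - i) = ∑ l ∈ Finset.range j, r ^ (l + 1) := by
  rw [← Finset.sum_range_reflect (fun l => r ^ (l + 1))]
  refine Finset.sum_congr rfl fun i hi => ?_
  rw [Finset.mem_range] at hi
  congr 1
  omega

/-- Splits the excitation into a centred martingale sum with deterministic integrand and its mean.
-/
theorem discreteExcitation_eq (N : Ω → Realization M) (μ : Fin M → ℝ) (β : ℝ) (p : Fin M)
    (h : ℝ≥0) (j : ℕ) (ω : Ω) :
    discreteExcitation N β p h j ω =
      discreteIntegral N μ p h (fun i _ => Real.exp (-β * h) ^ (j - i)) j ω +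
        μ p * (h * ∑ l ∈ Finset.range j, Real.exp (-β * h) ^ (l + 1)) := by
  rw [← sum_range_reflect_pow, discreteExcitation, discreteIntegral, Finset.mul_sum,
    Finset.mul_sum, ← Finset.sum_add_distrib]
  refine Finset.sum_congr rfl fun i _ => ?_
  rw [compIncrement]
  push_cast
  ring

theorem abs_discreteExcitation_le (N : Ω → Realization M) {β : ℝ} (hβ : 0 < β) (p : Fin M)
    (h : ℝ≥0) (j : ℕ) (ω : Ω) : |discreteExcitation N β p h j ω| ≤ counts N (j * h) ω p := by
  have hsum := sum_increment N p 0 h j ω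
  simp only [zero_add, increment_zero_left] at hsum
  rw [← hsum, discreteExcitation]
  refine (Finset.abs_sum_le_sum_abs _ _).trans (Finset.sum_le_sum fun i _ => ?_)
  have hinc : 0 ≤ increment N p (i * h) ((i + 1 : ℕ) * h) ω :=
    increment_nonneg N p (by gcongr; simp) ω
  rw [abs_of_nonneg (by positivity)]
  refine mul_le_of_le_one_left hinc (pow_le_one₀ (Real.exp_pos _).le ?_)
  rw [Real.exp_le_one_iff]
  nlinarith [h.2]

/-- The discretized score `S_T^{(p,q)}(0)`, on `n` intervals of length `h`. -/
noncomputable def discreteScore (N : Ω → Realization M) (μ : Fin M → ℝ) (β : ℝ) (p q : Fin M)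
    (h : ℝ≥0) (n : ℕ) (ω : Ω) : ℝ :=
  1 / μ q * discreteIntegral N μ q h (discreteExcitation N β p h) n ω

theorem abs_discreteScore_le (N : Ω → Realization M) {μ : Fin M → ℝ} (hμ : ∀ m, 0 < μ m) {β : ℝ}
    (hβ : 0 < β) (p q : Fin M) (h : ℝ≥0) (n : ℕ) (ω : Ω) :
    |discreteScore N μ β p q h n ω| ≤
      1 / μ q * (counts N (n * h) ω p * (counts N (n * h) ω q + μ q * (n * h : ℝ≥0))) := by
  have hq := hμ q
  rw [discreteScore, abs_mul, abs_of_pos (by positivity)]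
  gcongr
  have hstep : ∀ j : ℕ, (((j + 1 : ℕ) * h : ℝ≥0) : ℝ) - (j * h : ℝ≥0) = h := fun j => by
    push_cast
    ring
  have hsum : ∑ j ∈ Finset.range n, (increment N q (j * h) ((j + 1 : ℕ) * h) ω + μ q * h) =
      counts N (n * h) ω q + μ q * (n * h : ℝ≥0) := by
    have h0 := sum_increment N q 0 h n ω
    simp only [zero_add, increment_zero_left] at h0
    rw [Finset.sum_add_distrib, h0]
    simp
    ring
  rw [← hsum, Finset.mul_sum, discreteIntegral]
  refine (Finset.abs_sum_le_sum_abs _ _).trans (Finset.sum_le_sum fun j hj => ?_)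
  have h1 := abs_compIncrement_le N (hμ q) (s := j * h) (t := (j + 1 : ℕ) * h)
    (by gcongr; simp) ω
  rw [hstep] at h1
  have h2 : counts N (j * h) ω p ≤ counts N (n * h) ω p := by
    refine Nat.cast_le.2 ((N ω).count_mono p (NNReal.coe_le_coe.2 ?_))
    gcongr
    exact (Finset.mem_range.1 hj).le
  rw [abs_mul]
  exact mul_le_mul ((abs_discreteExcitation_le N hβ p h j ω).trans h2) h1 (abs_nonneg _)
    (Nat.cast_nonneg _)

namespace IsHawkes

variable [MeasurableSpace Ω] {P : Measure Ω} {N : Ω → Realization M} {μ : Fin M → ℝ} {β : ℝ}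

theorem stronglyMeasurable_discreteExcitation (hN : IsHawkes P N μ β 0) (p : Fin M) (h : ℝ≥0)
    (j : ℕ) : StronglyMeasurable[hN.history (j * h)] (discreteExcitation N β p h j) := by
  refine Finset.stronglyMeasurable_fun_sum _ fun i hi => ?_
  have hij : i + 1 ≤ j := Finset.mem_range.1 hi
  refine (hN.stronglyMeasurable_increment p ?_ ?_).const_mul _
  · gcongr
    exact (Nat.le_succ i).trans hij
  · gcongr

variable [IsProbabilityMeasure P] (hN : IsHawkes P N μ β 0) (hμ : ∀ m, 0 < μ m)

include hN hμ

theorem hasMoments_discreteExcitation (p : Fin M) (h : ℝ≥0) (j : ℕ) :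
    HasMoments (discreteExcitation N β p h j) P :=
  .sum _ fun _ _ => (hN.hasMoments_increment (hμ p) _ _).const_mul _

/-- The isometry applies to the centred parts, whose squared weights decay at rate `2β`. The cross
terms with the means vanish. -/
theorem integral_discreteExcitation_mul_discreteExcitation (p p' : Fin M) (h : ℝ≥0) (j : ℕ) :
    ∫ ω, discreteExcitation N β p h j ω * discreteExcitation N β p' h j ω ∂P =
      (if p = p' then
        μ p * (h * ∑ l ∈ Finset.range j, Real.exp (-(2 * β) * h) ^ (l + 1)) else 0) +
      μ p * μ p' * (h * ∑ l ∈ Finset.range j, Real.exp (-β * h) ^ (l + 1)) ^ 2 := by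
  set a := h * ∑ l ∈ Finset.range j, Real.exp (-β * h) ^ (l + 1) with ha
  set Y : ℕ → Ω → ℝ := fun i _ => Real.exp (-β * h) ^ (j - i) with hY
  have hYs : ∀ i : ℕ, StronglyMeasurable[hN.history (i * h)] (Y i) := fun i =>
    stronglyMeasurable_const
  have hYm : ∀ i, HasMoments (Y i) P := fun i => .const _
  have hI := fun m => hN.hasMoments_discreteIntegral hμ m h hYm j
  have hexpand : ∀ ω, discreteExcitation N β p h j ω * discreteExcitation N β p' h j ω =
      discreteIntegral N μ p h Y j ω * discreteIntegral N μ p' h Y j ω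
      + μ p' * a * discreteIntegral N μ p h Y j ω + μ p * a * discreteIntegral N μ p' h Y j ω
      + μ p * μ p' * a ^ 2 := fun ω => by
    rw [discreteExcitation_eq N μ, discreteExcitation_eq N μ]
    ring
  have hsq : ∑ i ∈ Finset.range j, ∫ ω, Y i ω * Y i ω ∂P =
      ∑ l ∈ Finset.range j, Real.exp (-(2 * β) * h) ^ (l + 1) := by
    rw [← sum_range_reflect_pow]
    refine Finset.sum_congr rfl fun i _ => ?_
    simp only [hY, integral_const, probReal_univ, one_smul]
    rw [← mul_pow, ← Real.exp_add]
    ring_nf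
  have i1 := (hI p).mul (hI p')
  have i2 := (hI p).const_mul (μ p' * a)
  have i3 := (hI p').const_mul (μ p * a)
  simp only [hexpand]
  rw [integral_add ((i1.add i2).add i3).integrable (integrable_const _),
    integral_add (i1.add i2).integrable i3.integrable, integral_add i1.integrable i2.integrable,
    integral_const_mul, integral_const_mul, hN.integral_discreteIntegral hμ p h hYs hYm,
    hN.integral_discreteIntegral hμ p' h hYs hYm,
    hN.integral_discreteIntegral_mul_discreteIntegral hμ p p' h hYs hYm hYs hYm, hsq]
  simp only [integral_const, probReal_univ, one_smul, mul_zero, add_zero, mul_assoc]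

theorem hasMoments_discreteScore (p q : Fin M) (h : ℝ≥0) (n : ℕ) :
    HasMoments (discreteScore N μ β p q h n) P :=
  (hN.hasMoments_discreteIntegral hμ q h (hN.hasMoments_discreteExcitation hμ p h) n).const_mul _

theorem integral_discreteScore (p q : Fin M) (h : ℝ≥0) (n : ℕ) :
    ∫ ω, discreteScore N μ β p q h n ω ∂P = 0 := by
  simp only [discreteScore]
  rw [integral_const_mul, hN.integral_discreteIntegral hμ q h
    (hN.stronglyMeasurable_discreteExcitation p h) (hN.hasMoments_discreteExcitation hμ p h),
    mul_zero]

theorem integral_discreteScore_mul_discreteScore (p q p' q' : Fin M) (h : ℝ≥0) (n : ℕ) :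
    ∫ ω, discreteScore N μ β p q h n ω * discreteScore N μ β p' q' h n ω ∂P =
      if q = q' then 1 / μ q *
        ((if p = p' then μ p * (h * ∑ j ∈ Finset.range n,
          h * ∑ l ∈ Finset.range j, Real.exp (-(2 * β) * h) ^ (l + 1)) else 0) +
        μ p * μ p' * (h * ∑ j ∈ Finset.range n,
          (h * ∑ l ∈ Finset.range j, Real.exp (-β * h) ^ (l + 1)) ^ 2)) else 0 := by
  have hq := (hμ q).ne'
  have hexpand : ∀ ω, discreteScore N μ β p q h n ω * discreteScore N μ β p' q' h n ω =
      1 / μ q * (1 / μ q') * (discreteIntegral N μ q h (discreteExcitation N β p h) n ω *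
        discreteIntegral N μ q' h (discreteExcitation N β p' h) n ω) := fun ω =>
    mul_mul_mul_comm _ _ _ _
  simp only [hexpand]
  rw [integral_const_mul, hN.integral_discreteIntegral_mul_discreteIntegral hμ q q' h
    (hN.stronglyMeasurable_discreteExcitation p h) (hN.hasMoments_discreteExcitation hμ p h)
    (hN.stronglyMeasurable_discreteExcitation p' h) (hN.hasMoments_discreteExcitation hμ p' h)]
  simp only [hN.integral_discreteExcitation_mul_discreteExcitation hμ, Finset.sum_add_distrib,
    ← Finset.mul_sum]
  split_ifs with h1 h2
  · subst h1
    simp only [← Finset.mul_sum]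
    field_simp
  · subst h1
    simp only [Finset.sum_const_zero, zero_add]
    field_simp
  · simp

end IsHawkes

end Hawkes

namespace Hawkes

variable {M : ℕ} {Ω : Type*}

/-! ### Pathwise convergence of the discretized score -/

/-- The index `j` of the grid interval `(jh, (j+1)h]` that contains `t > 0`. -/
noncomputable def gridIndex (h t : ℝ) : ℕ := ⌈t / h⌉₊ - 1

theorem gridIndex_eq_iff {h t : ℝ} (hh : 0 < h) (ht : 0 < t) (j : ℕ) :
    gridIndex h t = j ↔ j * h < t ∧ t ≤ (j + 1 : ℕ) * h := by
  -- Positivity keeps the natural subtraction in `gridIndex` from truncating.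
  have h1 : 0 < ⌈t / h⌉₊ := Nat.ceil_pos.2 (by positivity)
  have h2 : gridIndex h t = j ↔ ⌈t / h⌉₊ = j + 1 := by
    rw [gridIndex]
    omega
  rw [h2, Nat.ceil_eq_iff j.succ_ne_zero, lt_div_iff₀ hh, div_le_iff₀ hh, Nat.succ_sub_one]

theorem gridIndex_mul_lt {h t : ℝ} (hh : 0 < h) (ht : 0 < t) : gridIndex h t * h < t :=
  ((gridIndex_eq_iff hh ht _).1 rfl).1

theorem le_gridIndex_add_one_mul {h t : ℝ} (hh : 0 < h) (ht : 0 < t) :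
    t ≤ gridIndex h t * h + h := by
  have := ((gridIndex_eq_iff hh ht _).1 rfl).2
  push_cast at this
  linarith

theorem gridIndex_lt {h t : ℝ} (hh : 0 < h) (ht : 0 < t) {n : ℕ} (hn : t ≤ n * h) :
    gridIndex h t < n := by
  have h1 := (gridIndex_mul_lt hh ht).trans_le hn
  exact_mod_cast lt_of_mul_lt_mul_right h1 hh.le

theorem gridIndex_mono {h s t : ℝ} (hh : 0 < h) (hst : s ≤ t) :
    gridIndex h s ≤ gridIndex h t :=
  Nat.sub_le_sub_right (Nat.ceil_le_ceil (by gcongr)) 1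

theorem tendsto_gridIndex_mul {h : ℕ → ℝ} (hh : ∀ n, 0 < h n) (hlim : Tendsto h atTop (𝓝 0))
    {t : ℝ} (ht : 0 < t) : Tendsto (fun n => gridIndex (h n) t * h n) atTop (𝓝 t) := by
  have h1 : Tendsto (fun n => t - h n) atTop (𝓝 t) := by simpa using hlim.const_sub t
  refine tendsto_of_tendsto_of_tendsto_of_le_of_le h1 tendsto_const_nhds (fun n => ?_)
    fun n => (gridIndex_mul_lt (hh n) ht).le
  have := le_gridIndex_add_one_mul (hh n) ht
  simp only
  linarith

/-- Turns a sum over grid intervals into a sum over events, whose index set stays fixed as the mesh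
shrinks, so that limits can be taken term by term. -/
theorem sum_mul_increment (N : Ω → Realization M) (m : Fin M) {h T : ℝ≥0} (hh : 0 < h) {j : ℕ}
    (hj : j * h ≤ T) (φ : ℕ → ℝ) (ω : Ω) :
    ∑ i ∈ Finset.range j, φ i * increment N m (i * h) ((i + 1 : ℕ) * h) ω =
      ∑ e ∈ (N ω).nodeUpTo m T, if gridIndex h e.1 < j then φ (gridIndex h e.1) else 0 := by
  have hinc : ∀ i ∈ Finset.range j, φ i * increment N m (i * h) ((i + 1 : ℕ) * h) ω =
      ∑ e ∈ (N ω).nodeUpTo m T, if gridIndex h e.1 = i then φ i else 0 := fun i hi => by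
    have hij : i + 1 ≤ j := Finset.mem_range.1 hi
    have h1 : (i : ℝ≥0) * h ≤ (i + 1 : ℕ) * h := by
      gcongr
      simp
    have h2 : ((i + 1 : ℕ) : ℝ≥0) * h ≤ T := le_trans (by gcongr) hj
    rw [increment, counts, counts, (N ω).count_sub_count m (NNReal.coe_le_coe.2 h1)
      (NNReal.coe_le_coe.2 h2), Finset.mul_sum]
    refine Finset.sum_congr rfl fun e he => ?_
    have hpos := (N ω).time_pos e (Realization.mem_nodeUpTo.1 he).1.1
    have hiff := gridIndex_eq_iff (NNReal.coe_pos.2 hh) hpos i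
    push_cast at hiff ⊢
    simp only [hiff, mul_ite, mul_one, mul_zero]
  rw [Finset.sum_congr rfl hinc, Finset.sum_comm]
  refine Finset.sum_congr rfl fun e _ => ?_
  simp [Finset.sum_ite_eq]

theorem discreteIntegral_discreteExcitation (N : Ω → Realization M) (μ : Fin M → ℝ) (β : ℝ)
    (p q : Fin M) {h T : ℝ≥0} (hh : 0 < h) {n : ℕ} (hn : n * h = T) (ω : Ω) :
    discreteIntegral N μ q h (discreteExcitation N β p h) n ω =
      (∑ k ∈ (N ω).nodeUpTo q T, ∑ e ∈ (N ω).nodeUpTo p T,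
        if gridIndex h e.1 < gridIndex h k.1 then
          Real.exp (-β * h) ^ (gridIndex h k.1 - gridIndex h e.1) else 0)
      - μ q * ∑ e ∈ (N ω).nodeUpTo p T,
        h * ∑ l ∈ Finset.range (n - (gridIndex h e.1 + 1)), Real.exp (-β * h) ^ (l + 1) := by
  have hexc : ∀ j ≤ n, discreteExcitation N β p h j ω = ∑ e ∈ (N ω).nodeUpTo p T,
      if gridIndex h e.1 < j then Real.exp (-β * h) ^ (j - gridIndex h e.1) else 0 := fun j hj =>
    sum_mul_increment N p hh (hn ▸ (by gcongr)) _ ω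
  have hstep : ∀ j : ℕ, (((j + 1 : ℕ) * h : ℝ≥0) : ℝ) - (j * h : ℝ≥0) = h := fun j => by
    push_cast
    ring
  have hsplit : discreteIntegral N μ q h (discreteExcitation N β p h) n ω =
      (∑ j ∈ Finset.range n, discreteExcitation N β p h j ω *
        increment N q (j * h) ((j + 1 : ℕ) * h) ω) -
      μ q * (h * ∑ j ∈ Finset.range n, discreteExcitation N β p h j ω) := by
    simp only [discreteIntegral, compIncrement, hstep, mul_sub, Finset.sum_sub_distrib,
      Finset.mul_sum]
    congr 1
    exact Finset.sum_congr rfl fun j _ => by ring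
  rw [hsplit, sum_mul_increment N q hh hn.le (fun j => discreteExcitation N β p h j ω)]
  congr 1
  · refine Finset.sum_congr rfl fun k hk => ?_
    have hk' := Realization.mem_nodeUpTo.1 hk
    have hlt : gridIndex h k.1 < n := gridIndex_lt (NNReal.coe_pos.2 hh)
      ((N ω).time_pos k hk'.1.1) (by rw [← hn] at hk'; exact_mod_cast hk'.1.2)
    rw [if_pos hlt, hexc _ hlt.le]
  · congr 1
    rw [Finset.sum_congr rfl fun j hj => hexc j (Finset.mem_range.1 hj).le, Finset.sum_comm,
      Finset.mul_sum]
    refine Finset.sum_congr rfl fun e _ => ?_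
    congr 1
    rw [← Finset.sum_filter]
    have hfil : (Finset.range n).filter (fun j => gridIndex h e.1 < j) =
        Finset.Ico (gridIndex h e.1 + 1) n := by
      ext j
      simp only [Finset.mem_filter, Finset.mem_range, Finset.mem_Ico]
      omega
    rw [hfil, Finset.sum_Ico_eq_sum_range]
    refine Finset.sum_congr rfl fun l _ => ?_
    congr 1
    omega

theorem tendsto_kernel {β : ℝ} {h : ℕ → ℝ} (hh : ∀ n, 0 < h n) (hlim : Tendsto h atTop (𝓝 0))
    {s t : ℝ} (hs : 0 < s) (ht : 0 < t) :
    Tendsto (fun n => if gridIndex (h n) s < gridIndex (h n) t then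
      Real.exp (-β * h n) ^ (gridIndex (h n) t - gridIndex (h n) s) else 0) atTop
      (𝓝 (if s < t then Real.exp (-β * (t - s)) else 0)) := by
  have hs' := tendsto_gridIndex_mul hh hlim hs
  have ht' := tendsto_gridIndex_mul hh hlim ht
  split_ifs with hst
  · have key := (Real.continuous_exp.tendsto _).comp ((ht'.sub hs').const_mul (-β))
    refine key.congr' ?_
    filter_upwards [hs'.eventually_lt ht' hst] with n hn
    have hlt : gridIndex (h n) s < gridIndex (h n) t := by
      exact_mod_cast lt_of_mul_lt_mul_right hn (hh n).le
    rw [if_pos hlt, ← Real.exp_nat_mul, Nat.cast_sub hlt.le, Function.comp_apply]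
    congr 1
    ring
  -- For `t ≤ s` the term vanishes on every grid. This includes `s = t`: when `p = q` an event does
  -- not excite itself.
  · refine tendsto_const_nhds.congr fun n => ?_
    rw [if_neg (not_lt.2 (gridIndex_mono (hh n) (not_lt.1 hst)))]

/-- Riemann sums of `∫_t^T e^{-β(s - t)} ds`, starting at the first grid interval after the one
containing `t`. -/
theorem tendsto_compensator {β T : ℝ} (hβ : 0 < β) (hT : 0 < T) {t : ℝ} (ht : 0 < t)
    (htT : t ≤ T) :
    Tendsto (fun n : ℕ => T / (n + 1 : ℕ) *
      ∑ l ∈ Finset.range (n + 1 - (gridIndex (T / (n + 1 : ℕ)) t + 1)),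
        Real.exp (-β * (T / (n + 1 : ℕ))) ^ (l + 1)) atTop
      (𝓝 ((1 - Real.exp (-β * (T - t))) / β)) := by
  set h : ℕ → ℝ := fun n => T / (n + 1 : ℕ) with hh
  have hpos : ∀ n, 0 < h n := fun n => by positivity
  have hlim : Tendsto h atTop (𝓝 0) :=
    (tendsto_const_div_atTop_nhds_zero_nat T).comp (tendsto_add_atTop_nat 1)
  have hmul : ∀ n : ℕ, ((n + 1 : ℕ) : ℝ) * h n = T := fun n => mul_div_cancel₀ _ (by positivity)
  have hexp := (Real.continuous_exp.tendsto _).comp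
    (((hlim.add (tendsto_gridIndex_mul hpos hlim ht)).const_sub T).const_mul (-β))
  have key := ((tendsto_div_one_sub_exp hβ hpos hlim).mul
    (tendsto_exp_neg_mul (β := β) hlim)).mul (hexp.const_sub 1)
  rw [mul_one, zero_add, one_div_mul_eq_div] at key
  refine key.congr fun n => ?_
  have hle : gridIndex (h n) t + 1 ≤ n + 1 := gridIndex_lt (hpos n) ht (htT.trans (hmul n).ge)
  have hpow : Real.exp (-β * h n) ^ (n + 1 - (gridIndex (h n) t + 1)) =
      Real.exp (-β * (T - (h n + gridIndex (h n) t * h n))) := by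
    rw [← Real.exp_nat_mul, Nat.cast_sub hle, ← hmul n]
    congr 1
    push_cast
    ring
  change _ = h n * ∑ l ∈ Finset.range (n + 1 - (gridIndex (h n) t + 1)),
    Real.exp (-β * h n) ^ (l + 1)
  rw [sum_range_pow_succ (exp_neg_mul_ne_one hβ (hpos n)), hpow, Function.comp_apply]
  ring

/-- If there is no event at time `T`, the discretized scores converge to the score. -/
theorem tendsto_discreteScore (N : Ω → Realization M) {μ : Fin M → ℝ} (hμ : ∀ m, 0 < μ m) {β : ℝ}
    (hβ : 0 < β) (p q : Fin M) {T : ℝ≥0} (hT : 0 < T) {ω : Ω}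
    (hω : ∀ e ∈ (N ω).events, e.1 ≠ T) :
    Tendsto (fun n : ℕ => discreteScore N μ β p q (T / (n + 1 : ℕ)) (n + 1) ω) atTop
      (𝓝 ((N ω).score μ β T p q 0)) := by
  have hq := (hμ q).ne'
  have hT' : (0 : ℝ) < T := NNReal.coe_pos.2 hT
  have hpos : ∀ n : ℕ, 0 < (T : ℝ) / (n + 1 : ℕ) := fun n => by positivity
  have hlim : Tendsto (fun n : ℕ => (T : ℝ) / (n + 1 : ℕ)) atTop (𝓝 0) :=
    (tendsto_const_div_atTop_nhds_zero_nat (T : ℝ)).comp (tendsto_add_atTop_nat 1)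
  -- The counts include time `T` while the score does not; `hω` removes the difference.
  have heq : ∀ m, (N ω).nodeUpTo m T = (N ω).nodeBefore m T := fun m => by
    ext e
    rw [Realization.mem_nodeUpTo, Realization.mem_nodeBefore]
    exact ⟨fun h => ⟨⟨h.1.1, lt_of_le_of_ne h.1.2 (hω e h.1.1)⟩, h.2⟩,
      fun h => ⟨⟨h.1.1, h.1.2.le⟩, h.2⟩⟩
  have hmem : ∀ m, ∀ e ∈ (N ω).nodeUpTo m T, 0 < e.1 ∧ e.1 ≤ T := fun m e he =>
    have he' := Realization.mem_nodeUpTo.1 he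
    ⟨(N ω).time_pos e he'.1.1, he'.1.2⟩
  have h1 : Tendsto (fun n : ℕ => ∑ k ∈ (N ω).nodeUpTo q T, ∑ e ∈ (N ω).nodeUpTo p T,
      if gridIndex ((T : ℝ) / (n + 1 : ℕ)) e.1 < gridIndex ((T : ℝ) / (n + 1 : ℕ)) k.1 then
        Real.exp (-β * ((T : ℝ) / (n + 1 : ℕ))) ^
          (gridIndex ((T : ℝ) / (n + 1 : ℕ)) k.1 - gridIndex ((T : ℝ) / (n + 1 : ℕ)) e.1) else 0)
      atTop (𝓝 (∑ k ∈ (N ω).nodeUpTo q T, ∑ e ∈ (N ω).nodeUpTo p T,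
        if e.1 < k.1 then Real.exp (-β * (k.1 - e.1)) else 0)) :=
    tendsto_finsetSum _ fun k hk => tendsto_finsetSum _ fun e he =>
      tendsto_kernel hpos hlim (hmem p e he).1 (hmem q k hk).1
  have h2 : Tendsto (fun n : ℕ => ∑ e ∈ (N ω).nodeUpTo p T, (T : ℝ) / (n + 1 : ℕ) *
      ∑ l ∈ Finset.range (n + 1 - (gridIndex ((T : ℝ) / (n + 1 : ℕ)) e.1 + 1)),
        Real.exp (-β * ((T : ℝ) / (n + 1 : ℕ))) ^ (l + 1))
      atTop (𝓝 (∑ e ∈ (N ω).nodeUpTo p T, (1 - Real.exp (-β * (T - e.1))) / β)) :=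
    tendsto_finsetSum _ fun e he => tendsto_compensator hβ hT' (hmem p e he).1 (hmem p e he).2
  have key := (h1.sub (h2.const_mul (μ q))).const_mul (1 / μ q)
  convert key using 1
  · ext n
    rw [discreteScore, discreteIntegral_discreteExcitation N μ β p q (T := T) (by positivity)
      (mul_div_cancel₀ _ (by positivity))]
    push_cast
    rfl
  · congr 1
    rw [(N ω).score_zero hμ, mul_sub, one_div_mul_eq_div, ← mul_assoc, one_div_mul_cancel hq,
      one_mul, heq, heq]
    congr 2
    refine Finset.sum_congr rfl fun k hk => ?_
    rw [← Finset.sum_filter]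
    refine Finset.sum_congr ?_ fun _ _ => rfl
    ext e
    rw [Realization.mem_nodeBefore] at hk
    rw [Finset.mem_filter, Realization.mem_nodeBefore, Realization.mem_nodeBefore]
    exact ⟨fun h => ⟨⟨⟨h.1.1, h.1.2.trans hk.1.2⟩, h.2⟩, h.1.2⟩,
      fun h => ⟨⟨h.1.1.1, h.2⟩, h.1.2⟩⟩

end Hawkes

/-! ### Exact covariances of the scores and their limits. -/

namespace Hawkes

/-- The covariance of the scores `S_T^{(p,q)}(0)` and `S_T^{(p',q')}(0)`. -/
noncomputable def scoreCov {M : ℕ} (μ : Fin M → ℝ) (β T : ℝ) (p q p' q' : Fin M) : ℝ :=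
  if q = q' then 1 / μ q *
    ((if p = p' then μ p * (1 / (2 * β) * (T - (1 - Real.exp (-(2 * β) * T)) / (2 * β))) else 0) +
    μ p * μ p' * (1 / β ^ 2 * (T - 2 * ((1 - Real.exp (-β * T)) / β) +
      (1 - Real.exp (-(2 * β) * T)) / (2 * β)))) else 0

theorem tendsto_one_sub_exp_div {β : ℝ} (hβ : 0 < β) :
    Tendsto (fun T : ℝ => (1 - Real.exp (-β * T)) / β / T) atTop (𝓝 0) := by
  have h1 : Tendsto (fun T : ℝ => Real.exp (-β * T)) atTop (𝓝 0) :=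
    Real.tendsto_exp_atBot.comp (tendsto_id.const_mul_atTop_of_neg (neg_lt_zero.2 hβ))
  exact ((h1.const_sub 1).div_const β).div_atTop tendsto_id

theorem tendsto_scoreCov_div {M : ℕ} (μ : Fin M → ℝ) {β : ℝ} (hβ : 0 < β) (p q p' q' : Fin M) :
    Tendsto (fun T : ℝ => scoreCov μ β T p q p' q' / T) atTop
      (𝓝 (if q = q' then 1 / μ q * ((if p = p' then μ p * (1 / (2 * β)) else 0) +
        μ p * μ p' * (1 / β ^ 2)) else 0)) := by
  have h1 := tendsto_one_sub_exp_div hβ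
  have h2 := tendsto_one_sub_exp_div (mul_pos two_pos hβ)
  have h3 := (h2.const_sub 1).const_mul (μ p * (1 / (2 * β)))
  have h4 := (((h1.const_mul 2).const_sub 1).add h2).const_mul (μ p * μ p' * (1 / β ^ 2))
  simp only [sub_zero, mul_one, mul_zero, add_zero] at h3 h4
  by_cases hq : q = q'
  · by_cases hp : p = p'
    · simp only [scoreCov, if_pos hq, if_pos hp]
      refine ((h3.add h4).const_mul (1 / μ q)).congr' ?_
      filter_upwards [eventually_gt_atTop 0] with T hT
      field_simp
    · simp only [scoreCov, if_pos hq, if_neg hp, zero_add]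
      refine (h4.const_mul (1 / μ q)).congr' ?_
      filter_upwards [eventually_gt_atTop 0] with T hT
      field_simp
  · simp [scoreCov, if_neg hq]

theorem abs_discreteScore_grid_le {M : ℕ} {Ω : Type*} (N : Ω → Realization M) {μ : Fin M → ℝ}
    (hμ : ∀ m, 0 < μ m) {β : ℝ} (hβ : 0 < β) (p q : Fin M) (T : ℝ≥0) (n : ℕ) (ω : Ω) :
    |discreteScore N μ β p q (T / (n + 1 : ℕ)) (n + 1) ω| ≤
      1 / μ q * (counts N T ω p * (counts N T ω q + μ q * T)) := by
  have h := abs_discreteScore_le N hμ hβ p q (T / (n + 1 : ℕ)) (n + 1) ω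
  rwa [mul_div_cancel₀ _ (by positivity)] at h

namespace IsHawkes

variable {M : ℕ} {Ω : Type*} [MeasurableSpace Ω] {P : Measure Ω} [IsProbabilityMeasure P]
  {N : Ω → Realization M} {μ : Fin M → ℝ} {β : ℝ} (hN : IsHawkes P N μ β 0)
  (hμ : ∀ m, 0 < μ m)

include hN hμ

/-- Almost surely, there is no event at the fixed time `T`. -/
theorem ae_time_ne {T : ℝ≥0} (hT : 0 < T) : ∀ᵐ ω ∂P, ∀ e ∈ (N ω).events, e.1 ≠ T := by
  have hnode : ∀ m : Fin M, P {ω | ((T : ℝ), m) ∈ (N ω).events} = 0 := by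
    intro m
    have hlim : Tendsto (fun n : ℕ => ENNReal.ofReal (μ m * ((T : ℝ) / (n + 1 : ℕ)))) atTop
        (𝓝 0) := by
      have h := ((tendsto_const_div_atTop_nhds_zero_nat (T : ℝ)).comp
        (tendsto_add_atTop_nat 1)).const_mul (μ m)
      simpa using ENNReal.tendsto_ofReal h
    -- An event at `T` forces an increment of at least `1` over `(T - T/(n+1), T]`. By Markov's
    -- inequality this has probability at most `μ_m T/(n+1)`.
    refine le_antisymm (ge_of_tendsto' hlim fun n => ?_) zero_le
    have hle : T / (n + 1 : ℕ) ≤ T := div_le_self zero_le (by simp)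
    set s : ℝ≥0 := T - T / (n + 1 : ℕ) with hs
    have hsT : s ≤ T := tsub_le_self
    have hsT' : (T : ℝ) - s = T / (n + 1 : ℕ) := by
      rw [hs, NNReal.coe_sub hle]
      push_cast
      ring
    have hlint := hN.lintegral_mul_increment (hμ m) hsT (Y := fun _ => 1) measurable_const
    simp only [one_mul, lintegral_const, measure_univ, mul_one, hsT'] at hlint
    rw [← hlint]
    have hmeas : Measurable fun ω => ENNReal.ofReal (increment N m s T ω) :=
      ((hN.stronglyMeasurable_increment m hsT le_rfl).mono
        (hN.history.le T)).measurable.ennreal_ofReal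
    have hmarkov := mul_meas_ge_le_lintegral (μ := P) hmeas 1
    rw [one_mul] at hmarkov
    refine le_trans (measure_mono fun ω hω => ?_) hmarkov
    have hslt : (s : ℝ) < T := by
      have : 0 < (T : ℝ) / (n + 1 : ℕ) := by positivity
      linarith
    change 1 ≤ ENNReal.ofReal (increment N m s T ω)
    rw [ENNReal.one_le_ofReal, increment, counts, counts,
      (N ω).count_sub_count m (NNReal.coe_le_coe.2 hsT) le_rfl]
    have hmem : ((T : ℝ), m) ∈ (N ω).nodeUpTo m T :=
      Realization.mem_nodeUpTo.2 ⟨⟨hω, le_rfl⟩, rfl⟩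
    refine le_trans ?_ (Finset.single_le_sum (fun e _ => ?_) hmem)
    · simp [hslt]
    · split_ifs <;> simp
  have hall : ∀ᵐ ω ∂P, ∀ m : Fin M, ((T : ℝ), m) ∉ (N ω).events :=
    ae_all_iff.2 fun m => by simpa [ae_iff] using hnode m
  filter_upwards [hall] with ω hω e he hT
  exact hω e.2 (by rwa [← hT])

theorem hasMoments_scoreBound (p q : Fin M) (T : ℝ≥0) :
    HasMoments (fun ω => 1 / μ q * (counts N T ω p * (counts N T ω q + μ q * T))) P :=
  ((hN.hasMoments_counts (hμ p) T).mul
    ((hN.hasMoments_counts (hμ q) T).add (.const _))).const_mul _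

variable (hβ : 0 < β)

include hβ

theorem ae_tendsto_discreteScore (p q : Fin M) {T : ℝ≥0} (hT : 0 < T) :
    ∀ᵐ ω ∂P, Tendsto (fun n : ℕ => discreteScore N μ β p q (T / (n + 1 : ℕ)) (n + 1) ω) atTop
      (𝓝 ((N ω).score μ β T p q 0)) := by
  filter_upwards [hN.ae_time_ne hμ hT] with ω hω
  exact tendsto_discreteScore N hμ hβ p q hT hω

/-- Only the counts are assumed measurable; measurability of the score comes from its being an
almost sure limit of discretized scores, and so does the bound. -/
theorem hasMoments_score (p q : Fin M) {T : ℝ≥0} (hT : 0 < T) :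
    HasMoments (fun ω => (N ω).score μ β T p q 0) P := by
  have hlim := hN.ae_tendsto_discreteScore hμ hβ p q hT
  refine (hN.hasMoments_scoreBound hμ p q T).mono (aestronglyMeasurable_of_tendsto_ae atTop
    (fun n => (hN.hasMoments_discreteScore hμ p q _ _).integrable.aestronglyMeasurable) hlim) ?_
  filter_upwards [hlim] with ω hω
  exact le_of_tendsto' hω.abs fun n => abs_discreteScore_grid_le N hμ hβ p q T n ω

theorem integral_score (p q : Fin M) {T : ℝ≥0} (hT : 0 < T) :
    ∫ ω, (N ω).score μ β T p q 0 ∂P = 0 := by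
  have hlim := tendsto_integral_of_dominated_convergence (μ := P) _
    (fun n => (hN.hasMoments_discreteScore hμ p q (T / (n + 1 : ℕ))
      (n + 1)).integrable.aestronglyMeasurable)
    (hN.hasMoments_scoreBound hμ p q T).integrable
    (fun n => .of_forall fun ω => abs_discreteScore_grid_le N hμ hβ p q T n ω)
    (hN.ae_tendsto_discreteScore hμ hβ p q hT)
  simp only [hN.integral_discreteScore hμ] at hlim
  exact tendsto_nhds_unique hlim tendsto_const_nhds

/-- Dominated convergence in the exact grid formula; the grid sums are Riemann sums of `E[X_p X_p']`
over `[0, T]`. -/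
theorem integral_score_mul_score (p q p' q' : Fin M) {T : ℝ≥0} (hT : 0 < T) :
    ∫ ω, (N ω).score μ β T p q 0 * (N ω).score μ β T p' q' 0 ∂P = scoreCov μ β T p q p' q' := by
  have hT' : (0 : ℝ) < T := NNReal.coe_pos.2 hT
  have hlim := tendsto_integral_of_dominated_convergence (μ := P)
    (F := fun n ω => discreteScore N μ β p q (T / (n + 1 : ℕ)) (n + 1) ω *
      discreteScore N μ β p' q' (T / (n + 1 : ℕ)) (n + 1) ω)
    (f := fun ω => (N ω).score μ β T p q 0 * (N ω).score μ β T p' q' 0) _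
    (fun n => ((hN.hasMoments_discreteScore hμ p q (T / (n + 1 : ℕ)) (n + 1)).mul
      (hN.hasMoments_discreteScore hμ p' q' (T / (n + 1 : ℕ))
        (n + 1))).integrable.aestronglyMeasurable)
    ((hN.hasMoments_scoreBound hμ p q T).mul (hN.hasMoments_scoreBound hμ p' q' T)).integrable
    (fun n => .of_forall fun ω => by
      have h1 := abs_discreteScore_grid_le N hμ hβ p q T n ω
      rw [Real.norm_eq_abs, abs_mul]
      exact mul_le_mul h1 (abs_discreteScore_grid_le N hμ hβ p' q' T n ω) (abs_nonneg _)
        ((abs_nonneg _).trans h1))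
    (by
      filter_upwards [hN.ae_tendsto_discreteScore hμ hβ p q hT,
        hN.ae_tendsto_discreteScore hμ hβ p' q' hT] with ω h1 h2
      exact h1.mul h2)
  refine tendsto_nhds_unique hlim ?_
  simp only [hN.integral_discreteScore_mul_discreteScore hμ, scoreCov, NNReal.coe_div,
    NNReal.coe_natCast]
  split_ifs
  · exact (((tendsto_sum_geom (mul_pos two_pos hβ) hT').const_mul _).add
      ((tendsto_sum_geom_sq hβ hT').const_mul _)).const_mul _
  · exact (((tendsto_sum_geom_sq hβ hT').const_mul _).const_add 0).const_mul _
  · exact tendsto_const_nhds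

theorem memLp_normalizedScore (p q : Fin M) {T : ℝ} (hT : 0 < T) :
    MemLp (normalizedScore N μ β T p q 0) 2 P := by
  lift T to ℝ≥0 using hT.le
  exact_mod_cast ((hN.hasMoments_score hμ hβ p q (NNReal.coe_pos.1 hT)).const_mul _) 2

theorem covariance_normalizedScore (p q p' q' : Fin M) {T : ℝ} (hT : 0 < T) :
    covariance (normalizedScore N μ β T p q 0) (normalizedScore N μ β T p' q' 0) P =
      scoreCov μ β T p q p' q' / T := by
  rw [covariance_eq_sub (hN.memLp_normalizedScore hμ hβ p q hT)
    (hN.memLp_normalizedScore hμ hβ p' q' hT)]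
  lift T to ℝ≥0 using hT.le
  have hT' := NNReal.coe_pos.1 hT
  have hsq : (T : ℝ) ^ (-(1 / 2) : ℝ) * (T : ℝ) ^ (-(1 / 2) : ℝ) = 1 / T := by
    rw [← Real.rpow_add hT]
    norm_num [Real.rpow_neg_one]
  have hexpand : ∀ ω, (normalizedScore N μ β T p q 0 * normalizedScore N μ β T p' q' 0) ω =
      1 / T * ((N ω).score μ β T p q 0 * (N ω).score μ β T p' q' 0) := fun ω => by
    rw [← hsq]
    exact mul_mul_mul_comm _ _ _ _
  have hmean : ∫ ω, normalizedScore N μ β T p q 0 ω ∂P = 0 := by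
    simp only [normalizedScore]
    rw [integral_const_mul, hN.integral_score hμ hβ p q hT', mul_zero]
  simp only [hexpand]
  rw [integral_const_mul, hN.integral_score_mul_score hμ hβ p q p' q' hT', hmean, zero_mul,
    sub_zero, one_div_mul_eq_div]

theorem tendsto_covariance_normalizedScore (p q p' q' : Fin M) :
    Tendsto (fun T : ℝ => covariance (normalizedScore N μ β T p q 0)
      (normalizedScore N μ β T p' q' 0) P) atTop
      (𝓝 (if q = q' then 1 / μ q * ((if p = p' then μ p * (1 / (2 * β)) else 0) +
        μ p * μ p' * (1 / β ^ 2)) else 0)) := by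
  refine (tendsto_scoreCov_div μ hβ p q p' q').congr' ?_
  filter_upwards [eventually_gt_atTop 0] with T hT
  exact (hN.covariance_normalizedScore hμ hβ p q p' q' hT).symm

theorem tendsto_variance_normalizedScore (p q : Fin M) :
    Tendsto (fun T : ℝ => variance (normalizedScore N μ β T p q 0) P) atTop
      (𝓝 (μ p / μ q * (1 / (2 * β) + μ p / β ^ 2))) := by
  have h := hN.tendsto_covariance_normalizedScore hμ hβ p q p q
  rw [if_pos rfl, if_pos rfl] at h
  have hval : 1 / μ q * (μ p * (1 / (2 * β)) + μ p * μ p * (1 / β ^ 2)) =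
      μ p / μ q * (1 / (2 * β) + μ p / β ^ 2) := by ring
  rw [hval] at h
  refine h.congr' ?_
  filter_upwards [eventually_gt_atTop 0] with T hT
  exact covariance_self (hN.memLp_normalizedScore hμ hβ p q hT).aestronglyMeasurable.aemeasurable

end IsHawkes

end Hawkes

theorem theorem1 {M : ℕ} (μ : Fin M → ℝ) (hμ : ∀ m, 0 < μ m) (β : ℝ) (hβ : 0 < β) :
    -- the closed form of the score, for every realization of the process
    (∀ A : Matrix (Fin M) (Fin M) ℝ, (∀ i j, 0 ≤ A i j) →
      ∀ (x : Hawkes.Realization M) (T : ℝ) (p q : Fin M),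
        LineDifferentiableAt ℝ (x.logLikelihood μ β T) A (Matrix.single p q 1) ∧
        x.score μ β T p q A =
          (∑ k ∈ x.nodeBefore q T,
            (∑ i ∈ x.nodeBefore p k.1, Real.exp (-β * (k.1 - i.1))) /
              (μ q + ∑ i ∈ x.before k.1, A i.2 q * Real.exp (-β * (k.1 - i.1))))
          + (1 / β) * ∑ k ∈ x.nodeBefore p T, (Real.exp (-β * (T - k.1)) - 1)) ∧
    -- the limits of the variances and covariances of the normalized scores when `A = 0`
    (∀ {Ω : Type*} [MeasurableSpace Ω] (P : Measure Ω) [IsProbabilityMeasure P]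
      (N : Ω → Hawkes.Realization M), Hawkes.IsHawkes P N μ β 0 →
        (∀ T : ℝ, 0 < T → ∀ p q, MemLp (Hawkes.normalizedScore N μ β T p q 0) 2 P) ∧
        (∀ q, Tendsto (fun T : ℝ => variance (Hawkes.normalizedScore N μ β T q q 0) P) atTop
          (𝓝 (1 / (2 * β) + μ q / β ^ 2))) ∧
        (∀ p q, p ≠ q →
          Tendsto (fun T : ℝ => variance (Hawkes.normalizedScore N μ β T p q 0) P) atTop
            (𝓝 (μ p / μ q * (1 / (2 * β) + μ p / β ^ 2)))) ∧
        (∀ p p' q, p ≠ p' →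
          Tendsto (fun T : ℝ => covariance (Hawkes.normalizedScore N μ β T p q 0)
            (Hawkes.normalizedScore N μ β T p' q 0) P) atTop
            (𝓝 (μ p * μ p' / (μ q * β ^ 2)))) ∧
        (∀ p q p' q', q ≠ q' →
          Tendsto (fun T : ℝ => covariance (Hawkes.normalizedScore N μ β T p q 0)
            (Hawkes.normalizedScore N μ β T p' q' 0) P) atTop (𝓝 0))) := by
  refine ⟨fun A hA x T p q => ?_, fun P _ N hN => ⟨fun T hT p q => ?_, fun q => ?_,
    fun p q _ => ?_, fun p p' q hp => ?_, fun p q p' q' hq => ?_⟩⟩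
  · have h := x.hasLineDerivAt_logLikelihood hμ β T hA p q
    exact ⟨h.lineDifferentiableAt, h.lineDeriv⟩
  · exact hN.memLp_normalizedScore hμ hβ p q hT
  -- The variance limit has one formula for all `p, q`; for `p = q` the prefactor `μ_p / μ_q` is
  -- `1`.
  · simpa [div_self (hμ q).ne'] using hN.tendsto_variance_normalizedScore hμ hβ q q
  · exact hN.tendsto_variance_normalizedScore hμ hβ p q
  · have h := hN.tendsto_covariance_normalizedScore hμ hβ p q p' q
    rw [if_pos rfl, if_neg hp, zero_add] at h
    convert h using 2
    have := (hμ q).ne'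
    field_simp
  · simpa [hq] using hN.tendsto_covariance_normalizedScore hμ hβ p q p' q'
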